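/- Proposition 3.3. Let $n\ge 2$. For multi-indices $\alpha,\beta\in\mathbb N^n$ write $|\alpha|=\alpha_1+\dots+\alpha_n$, and let $S_{\alpha,\beta}$ be the set of Schwartz functions $\Upsilon:\mathbb R^n\to\mathbb C$ with $\sup_{x}|x^{\alpha'}\partial^{\beta'}\Upsilon(x)|\le 1$ for all $\alpha',\beta'\in\mathbb N^n$ with $|\alpha'|\le|\alpha|$ and $|\beta'|\le|\beta|$. Write $g_t(x)=t^{-n}g(x/t)$ for $t>0$ and $(f*g)(x)=\int_{\mathbb R^n}f(x-y)g(y)\,dy$. For $0<\delta<1$ put $$\Upsilon_I(x)=\delta^{-(n-1)}\,\Upsilon\Big(\frac{x_1}{\delta},\dots,\frac{x_{n-1}}{\delta},x_n\Big),\qquad \Upsilon_{AI_t}(y)=t^{-n}\,\Upsilon_I\Big(\frac{A^{-1}y}{t}\Big)\quad(A\in O(\mathbb R^n),\ t>0),$$ $$M_{\delta S_{\alpha,\beta}}f(x)=\sup_{t>0,\;A\in O(\mathbb R^n),\;\Upsilon\in S_{\alpha,\beta}}\big|(f*\Upsilon_{AI_t})(x)\big|,$$ and, for a Schwartz function $\psi$,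 let $(f*\psi)_\nabla(x)=\sup\{|(f*\psi_t)(y)|:\ t>0,\ y\in\mathbb R^n,\ |x-y|\le t\}$ be the nontangential maximal function. Then there is a number $L$, depending only on $n$, such that the following holds for all $\alpha,\beta\in\mathbb N^n$ with $|\alpha|\ge L$ and $|\beta|\ge L$, all $1<p\le\infty$, every $\varepsilon>0$, and every Schwartz function $\varphi$ on $\mathbb R^n$ whose Fourier transform $\widehat\varphi(\xi)=\int\varphi(x)e^{-2\pi i\langle x,\xi\rangle}dx$ equals $1$ for $|\xi|\le1$, vanishes for $|\xi|\ge2$, and satisfies $\widehat\varphi(A\xi)=\widehat\varphi(\xi)$ for all $A\in O(\mathbb R^n)$. There is a constant $C>0$, depending only on $\alpha,\beta,p,n,\varphi,\varepsilon$, such that for all $0<\delta<1$ and all $f\in L^p(\mathbb R^n)$, $$\|M_{\delta S_{\alpha,\beta}}f\|_p\le C\,\delta^{-\varepsilon}\,\|(f*\varphi_\delta)_\nabla\|_p\qquad\text{and}\qquad \|M_{\delta S_{\alpha,\beta}}f\|_p\le C\,\delta^{-\frac np-\varepsilon}\,\|f\|_p,$$ where $n/p=0$ if $p=\infty$. -/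

import Mathlib

open MeasureTheory
open scoped ENNReal SchwartzMap FourierTransform LineDeriv

namespace KakeyaMax

/-- The Euclidean space `ℝⁿ`. -/
abbrev Rn (n : ℕ) : Type := EuclideanSpace ℝ (Fin n)

/-- The length `|α| = α₁ + ⋯ + αₙ` of a multi-index. -/
def multiLen {n : ℕ} (α : Fin n → ℕ) : ℕ := ∑ i, α i

/-- The monomial `x ^ α = x₁ ^ α₁ ⋯ xₙ ^ αₙ`. -/
def monomialAt {n : ℕ} (α : Fin n → ℕ) (x : Rn n) : ℝ := ∏ i, x i ^ α i

/-- The mixed partial derivative `∂₁ ^ β₁ ⋯ ∂ₙ ^ βₙ φ` of a Schwartz function. -/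
noncomputable def mixedDeriv {n : ℕ} (β : Fin n → ℕ) (φ : 𝓢(Rn n, ℂ)) : 𝓢(Rn n, ℂ) :=
  (List.finRange n).foldr
    (fun i g => (fun h : 𝓢(Rn n, ℂ) => ∂_{(EuclideanSpace.single i 1 : Rn n)} h)^[β i] g) φ

/-- The class `S_{α,β}`: the Schwartz functions `φ` with `sup_x |x ^ α' ∂ ^ β' φ(x)| ≤ 1`
whenever `|α'| ≤ |α|` and `|β'| ≤ |β|`. -/
def schwartzClass {n : ℕ} (α β : Fin n → ℕ) : Set 𝓢(Rn n, ℂ) :=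
  {φ | ∀ α' β' : Fin n → ℕ, multiLen α' ≤ multiLen α → multiLen β' ≤ multiLen β →
    ∀ x : Rn n, ‖(monomialAt α' x : ℂ) * mixedDeriv β' φ x‖ ≤ 1}

/-- The isotropic dilation `g_t(x) = t⁻ⁿ g(x / t)`. -/
noncomputable def dilate {n : ℕ} (t : ℝ) (g : Rn n → ℂ) (x : Rn n) : ℂ :=
  (((t ^ n)⁻¹ : ℝ) : ℂ) * g (t⁻¹ • x)

/-- The linear map `x ↦ (x₁ / δ, …, xₙ₋₁ / δ, xₙ)`. -/
noncomputable def squeeze {n : ℕ} (δ : ℝ) (x : Rn n) : Rn n :=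
  WithLp.toLp 2 fun i : Fin n => if (i : ℕ) + 1 < n then x i / δ else x i

/-- The anisotropic dilation `g_I(x) = δ ^ (-(n - 1)) g(x₁ / δ, …, xₙ₋₁ / δ, xₙ)`. -/
noncomputable def anisoDilate {n : ℕ} (δ : ℝ) (g : Rn n → ℂ) (x : Rn n) : ℂ :=
  (((δ ^ (n - 1))⁻¹ : ℝ) : ℂ) * g (squeeze δ x)

/-- The convolution `(f * g)(x) = ∫ f(x - y) g(y) dy`. -/
noncomputable def conv {n : ℕ} (f g : Rn n → ℂ) (x : Rn n) : ℂ :=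
  ∫ y, f (x - y) * g y

/-- The maximal function `M_{δS_{α,β}} f(x)`: the supremum of
`|∫ f(x - y) t⁻ⁿ Υ_I(A⁻¹ y / t) dy|` over `t > 0`, `A ∈ O(ℝⁿ)` and `Υ ∈ S_{α,β}`. -/
noncomputable def kakeyaMaximal {n : ℕ} (δ : ℝ) (α β : Fin n → ℕ) (f : Rn n → ℂ)
    (x : Rn n) : ℝ≥0∞ :=
  ⨆ (t : ℝ) (_ : 0 < t) (A : Rn n ≃ₗᵢ[ℝ] Rn n) (Υ : 𝓢(Rn n, ℂ)) (_ : Υ ∈ schwartzClass α β),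
    ‖conv f (fun y => dilate t (anisoDilate δ Υ) (A.symm y)) x‖ₑ

/-- The nontangential maximal function
`(f * ψ)_∇(x) = sup {|(f * ψ_t)(y)| : t > 0, |x - y| ≤ t}`. -/
noncomputable def nontangentialMaximal {n : ℕ} (ψ f : Rn n → ℂ) (x : Rn n) : ℝ≥0∞ :=
  ⨆ (t : ℝ) (_ : 0 < t) (y : Rn n) (_ : ‖x - y‖ ≤ t), ‖conv f (dilate t ψ) y‖ₑ

/-- The cutoff function `φ`: its Fourier transform is `1` on the unit ball, `0` outside the ball
of radius `2`, and invariant under the orthogonal group. -/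
structure IsCutoff {n : ℕ} (φ : 𝓢(Rn n, ℂ)) : Prop where
  eq_one : ∀ ξ : Rn n, ‖ξ‖ ≤ 1 → 𝓕 φ ξ = 1
  eq_zero : ∀ ξ : Rn n, 2 ≤ ‖ξ‖ → 𝓕 φ ξ = 0
  radial : ∀ (A : Rn n ≃ₗᵢ[ℝ] Rn n) (ξ : Rn n), 𝓕 φ (A ξ) = 𝓕 φ ξ

end KakeyaMax

/-! After a translation, dilation and rotation it suffices to bound `(f * K)(0)` for a single tube
kernel `K = Υ_I`. With the scales `s_k = δ 2^{-k}`, write `K = K * φ_{s_0} + ∑ (K * φ_{s_{k+1}} - K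
* φ_{s_k})`. The symbol of `φ_{s/2}` equals one wherever those of `φ_s` and `φ_s - φ_{2s}` are
nonzero, so every term has the form `φ_{s/2} * e`, and `f` enters only through `f * φ_{s/2}`. The
symbol of `φ_s - φ_{2s}` vanishes near the origin, hence is divisible by that of `∑ ∂ᵢ^{2n}`; moving
these derivatives onto `K` gains `(s/δ)^{2n}`.

Let `G` be the nontangential maximal function of `f * φ_δ` and `M` the Hardy-Littlewood operator.
Since `|f * φ_{δτ}(u)| ≤ G(z)` for all `z` within `τ` of `u`, averaging over `B(u, τ) ⊆ B(0, τ +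
|u|)` gives `|f * φ_{δτ}(u)| ≤ (1 + |u|/τ)^n MG(0)`. At `τ ~ 2^{-k}` this loses `2^{kn}` against the
gain `2^{-2kn}`, so the series converges and `M_δ f ≤ C MG` pointwise
(`IsCutoff.exists_enorm_conv_anisoDilate_le`, `IsCutoff.exists_kakeyaMaximal_le`). The `L^p` bound
for `M` yields the first inequality.

For the second, `G` is at most a constant times the maximal function of aperture `2/δ`
(`exists_nontangentialMaximal_le`), whose `L^p` norm is `O(δ^{-n/p})` by interpolation between weak
type `(1,1)` with constant `O(δ^{-n})` and `L^∞` (`exists_eLpNorm_tentMaximal_le`). Both estimates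
come out without `δ^{-ε}`, which is inserted at the end because it is at least one. -/

namespace KakeyaMax

/-! ### Maximal functions of large aperture. -/

section Maximal

open Metric Set

variable {E : Type*} [NormedAddCommGroup E] [MeasurableSpace E]

/-- The maximal function of aperture `a` with respect to `μ`: the supremum of the averages of `f`
over the balls `B(y, r)` with `dist x y < a * r`. -/
noncomputable def tentMaximal (μ : Measure E) (a : ℝ) (f : E → ℝ≥0∞) (x : E) : ℝ≥0∞ :=
  ⨆ (y : E) (r : ℝ) (_ : dist x y < a * r), (μ (ball y r))⁻¹ * ∫⁻ z in ball y r, f z ∂μ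

lemma lt_tentMaximal_iff {μ : Measure E} {a : ℝ} {f : E → ℝ≥0∞} {x : E} {l : ℝ≥0∞} :
    l < tentMaximal μ a f x ↔
      ∃ y r, dist x y < a * r ∧ l < (μ (ball y r))⁻¹ * ∫⁻ z in ball y r, f z ∂μ := by
  simp only [tentMaximal, lt_iSup_iff, exists_prop]

lemma le_tentMaximal {μ : Measure E} {a : ℝ} {f : E → ℝ≥0∞} {x y : E} {r : ℝ}
    (h : dist x y < a * r) :
    (μ (ball y r))⁻¹ * ∫⁻ z in ball y r, f z ∂μ ≤ tentMaximal μ a f x :=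
  le_iSup_of_le y (le_iSup_of_le r (le_iSup_of_le h le_rfl))

lemma tentMaximal_congr_ae {μ : Measure E} (a : ℝ) {f g : E → ℝ≥0∞} (h : f =ᵐ[μ] g) :
    tentMaximal μ a f = tentMaximal μ a g := by
  ext x
  simp only [tentMaximal, lintegral_congr_ae (ae_restrict_of_ae h)]

/-- The strict inequality in the aperture condition makes each superlevel set a union of open balls.
This supplies measurability for every `f`. -/
lemma lowerSemicontinuous_tentMaximal (μ : Measure E) (a : ℝ) (f : E → ℝ≥0∞) :
    LowerSemicontinuous (tentMaximal μ a f) := by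
  rw [lowerSemicontinuous_iff_isOpen_preimage]
  intro l
  have : tentMaximal μ a f ⁻¹' Ioi l = ⋃ (y : E) (r : ℝ)
      (_ : l < (μ (ball y r))⁻¹ * ∫⁻ z in ball y r, f z ∂μ), ball y (a * r) := by
    ext x
    simp only [mem_preimage, mem_Ioi, lt_tentMaximal_iff, mem_iUnion, mem_ball, exists_prop,
      and_comm]
  rw [this]
  exact isOpen_iUnion fun _ => isOpen_iUnion fun _ => isOpen_iUnion fun _ => isOpen_ball

variable [NormedSpace ℝ E] [FiniteDimensional ℝ E] [BorelSpace E] [Nontrivial E]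
  (μ : Measure E) [μ.IsAddHaarMeasure]

open Module in
/-- The maximal function of aperture `a` is of weak type `(1, 1)`. -/
lemma measure_lt_tentMaximal_le {a : ℝ} (ha : 1 ≤ a) (f : E → ℝ≥0∞) {l : ℝ≥0∞} (hl : l ≠ 0)
    (hl' : l ≠ ∞) :
    μ {x | l < tentMaximal μ a f x} ≤
      ENNReal.ofReal ((5 * a) ^ finrank ℝ E) * (l⁻¹ * ∫⁻ z, f z ∂μ) := by
  by_cases hf : ∫⁻ z, f z ∂μ = ∞
  · have h1 : ENNReal.ofReal ((5 * a) ^ finrank ℝ E) ≠ 0 := by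
      have : 0 < (5 * a) ^ finrank ℝ E := by positivity
      simpa using this
    rw [hf, ENNReal.mul_top (by simpa using hl'), ENNReal.mul_top h1]
    exact le_top
  have hd : finrank ℝ E ≠ 0 := (finrank_pos (R := ℝ) (M := E)).ne'
  set t : Set (E × ℝ) := {b | 0 < b.2 ∧
    l < (μ (ball b.1 b.2))⁻¹ * ∫⁻ z in ball b.1 b.2, f z ∂μ} with ht
  have hball (b : E × ℝ) (hb : b ∈ t) : μ (ball b.1 b.2) ≤ l⁻¹ * ∫⁻ z in ball b.1 b.2, f z ∂μ := by
    have h0 : μ (ball b.1 b.2) ≠ 0 := (measure_ball_pos μ _ hb.1).ne'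
    have h1 : μ (ball b.1 b.2) ≠ ∞ := measure_ball_lt_top.ne
    have h2 := hb.2.le
    rw [← ENNReal.div_eq_inv_mul, ENNReal.le_div_iff_mul_le (Or.inl h0) (Or.inl h1)] at h2
    rw [← ENNReal.div_eq_inv_mul, ENNReal.le_div_iff_mul_le (Or.inl hl) (Or.inl hl'), mul_comm]
    exact h2
  -- Vitali covering needs bounded radii: a ball with average above `l` has volume at most `l⁻¹ ∫
  -- f`. The maximum with 1 is there so that `r ≤ r ^ d`.
  obtain ⟨R, hR⟩ : ∃ R : ℝ, ∀ b ∈ t, b.2 ≤ R := by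
    have hT : l⁻¹ * (∫⁻ z, f z ∂μ) * (μ (ball 0 1))⁻¹ ≠ ∞ :=
      ENNReal.mul_ne_top (ENNReal.mul_ne_top (by simpa using hl) hf)
        (by simpa using (measure_ball_pos μ (0 : E) one_pos).ne')
    refine ⟨max 1 (l⁻¹ * (∫⁻ z, f z ∂μ) * (μ (ball 0 1))⁻¹).toReal, fun b hb => ?_⟩
    by_contra! hcon
    obtain ⟨h1, h2⟩ := max_lt_iff.1 hcon
    have h3 : b.2 ≤ b.2 ^ finrank ℝ E := le_self_pow₀ h1.le hd
    have h4 := (hball b hb).trans (mul_le_mul_right (setLIntegral_le_lintegral _ _) _)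
    rw [μ.addHaar_ball _ hb.1.le] at h4
    have h5 : ENNReal.ofReal (b.2 ^ finrank ℝ E) ≤
        l⁻¹ * (∫⁻ z, f z ∂μ) * (μ (ball 0 1))⁻¹ := by
      rw [← div_eq_mul_inv, ENNReal.le_div_iff_mul_le
        (Or.inl (measure_ball_pos μ (0 : E) one_pos).ne') (Or.inl measure_ball_lt_top.ne)]
      exact h4
    have h6 := (ENNReal.ofReal_le_iff_le_toReal hT).1 h5
    linarith
  obtain ⟨u, hut, hdisj, hu⟩ := Vitali.exists_disjoint_subfamily_covering_enlargement
    (fun b : E × ℝ => ball b.1 b.2) t (fun b => b.2) 2 one_lt_two (fun b hb => hb.1.le) R hR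
    (fun b hb => nonempty_ball.2 hb.1)
  have hcount : u.Countable := hdisj.countable_of_isOpen (fun b _ => isOpen_ball)
    (fun b hb => nonempty_ball.2 (hut hb).1)
  -- The selected ball `b` meets `B(y, r)` and `r ≤ 2 * b.2`, so `x` lies within `a r + r + b.2 ≤
  -- (2a + 3) b.2 ≤ 5a b.2` of its centre, as `1 ≤ a`.
  have hsub : {x | l < tentMaximal μ a f x} ⊆ ⋃ b ∈ u, ball b.1 (5 * a * b.2) := by
    intro x hx
    obtain ⟨y, r, hxy, hyr⟩ := lt_tentMaximal_iff.1 hx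
    have hr : 0 < r := by
      have := dist_nonneg.trans_lt hxy
      by_contra! h
      nlinarith
    obtain ⟨b, hb, ⟨w, hw1, hw2⟩, hrb⟩ := hu (y, r) ⟨hr, hyr⟩
    refine mem_iUnion₂.2 ⟨b, hb, ?_⟩
    simp only [mem_ball] at hw1 hw2 ⊢
    have h1 := dist_triangle4 x y w b.1
    rw [dist_comm] at hw1
    have hb0 := (hut hb).1
    simp only at hrb
    nlinarith
  calc μ {x | l < tentMaximal μ a f x}
      ≤ μ (⋃ b ∈ u, ball b.1 (5 * a * b.2)) := measure_mono hsub
    _ ≤ ∑' b : u, μ (ball b.1.1 (5 * a * b.1.2)) := measure_biUnion_le _ hcount _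
    _ ≤ ∑' b : u, ENNReal.ofReal ((5 * a) ^ finrank ℝ E) *
          (l⁻¹ * ∫⁻ z in ball b.1.1 b.1.2, f z ∂μ) := by
        refine ENNReal.tsum_le_tsum fun b => ?_
        have hb0 := (hut b.2).1
        rw [μ.addHaar_ball _ (by positivity), mul_pow, ENNReal.ofReal_mul (by positivity),
          mul_assoc, ← μ.addHaar_ball b.1.1 hb0.le]
        exact mul_le_mul_right (hball b (hut b.2)) _
    _ = ENNReal.ofReal ((5 * a) ^ finrank ℝ E) *
          (l⁻¹ * ∑' b : u, ∫⁻ z in ball b.1.1 b.1.2, f z ∂μ) := by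
        rw [ENNReal.tsum_mul_left, ENNReal.tsum_mul_left]
    _ ≤ _ := by
        refine mul_le_mul_right (mul_le_mul_right ?_ _) _
        rw [← lintegral_biUnion hcount (fun b _ => measurableSet_ball) hdisj]
        exact setLIntegral_le_lintegral _ _

open Module in
/-- The weak type `(1, 1)` bound with the integral restricted to the set where `f` is large. -/
lemma measure_lt_tentMaximal_le_setLIntegral {a : ℝ} (ha : 1 ≤ a) {f : E → ℝ≥0∞}
    (hf : Measurable f) {l : ℝ≥0∞} (hl : l ≠ 0) (hl' : l ≠ ∞) :
    μ {x | 2 * l < tentMaximal μ a f x} ≤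
      ENNReal.ofReal ((5 * a) ^ finrank ℝ E) * (l⁻¹ * ∫⁻ z in {z | l < f z}, f z ∂μ) := by
  have hmeas : MeasurableSet {z | l < f z} := measurableSet_lt measurable_const hf
  rw [← lintegral_indicator hmeas]
  refine (measure_mono fun x hx => ?_).trans (measure_lt_tentMaximal_le μ ha _ hl hl')
  obtain ⟨y, r, hxy, hyr⟩ := lt_tentMaximal_iff.1 hx
  refine lt_tentMaximal_iff.2 ⟨y, r, hxy, ?_⟩
  have hr : 0 < r := by
    have := dist_nonneg.trans_lt hxy
    by_contra! h
    nlinarith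
  have h0 : μ (ball y r) ≠ 0 := (measure_ball_pos μ _ hr).ne'
  have h1 : μ (ball y r) ≠ ∞ := measure_ball_lt_top.ne
  -- Values of `f` at most `l` contribute at most `l` to an average, so an average above `2 * l`
  -- stays above `l` after truncation.
  have h2 : (μ (ball y r))⁻¹ * ∫⁻ z in ball y r, f z ∂μ ≤
      (μ (ball y r))⁻¹ * (∫⁻ z in ball y r, {z | l < f z}.indicator f z ∂μ) + l := by
    calc (μ (ball y r))⁻¹ * ∫⁻ z in ball y r, f z ∂μ
        ≤ (μ (ball y r))⁻¹ * ∫⁻ z in ball y r, ({z | l < f z}.indicator f z + l) ∂μ := by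
          refine mul_le_mul_right (lintegral_mono fun z => ?_) _
          by_cases h : l < f z
          · simp [h]
          · rw [indicator_of_notMem (by exact h), zero_add]
            exact not_lt.1 h
      _ = _ := by
          rw [lintegral_add_right _ measurable_const, mul_add]
          simp only [lintegral_const, Measure.restrict_apply MeasurableSet.univ, univ_inter]
          rw [mul_comm l, ← mul_assoc, ENNReal.inv_mul_cancel h0 h1, one_mul]
  have h3 := hyr.trans_le h2
  rw [two_mul] at h3
  exact lt_of_add_lt_add_right h3

/-- The power of an extended nonnegative number as an integral over its sublevels. -/
lemma ennreal_rpow_eq_lintegral {q : ℝ} (hq : 0 < q) (g : ℝ≥0∞) :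
    g ^ q = ∫⁻ t in Ioi (0 : ℝ),
      {t : ℝ | ENNReal.ofReal t < g}.indicator (fun t => ENNReal.ofReal (q * t ^ (q - 1))) t := by
  have key (b : ℝ) (hb : 0 ≤ b) :
      ∫⁻ t in Ioc (0 : ℝ) b, ENNReal.ofReal (q * t ^ (q - 1)) = ENNReal.ofReal b ^ q := by
    have hint : IntervalIntegrable (fun t : ℝ => q * t ^ (q - 1)) volume 0 b :=
      (intervalIntegral.intervalIntegrable_rpow' (by linarith)).const_mul _
    rw [← ofReal_integral_eq_lintegral_ofReal
      ((intervalIntegrable_iff_integrableOn_Ioc_of_le hb).1 hint)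
      ((ae_restrict_mem measurableSet_Ioc).mono fun t ht =>
        mul_nonneg hq.le (Real.rpow_nonneg ht.1.le _)),
      ← intervalIntegral.integral_of_le hb, intervalIntegral.integral_const_mul,
      integral_rpow (Or.inl (by linarith)), ENNReal.ofReal_rpow_of_nonneg hb hq.le]
    congr 1
    simp only [sub_add_cancel, Real.zero_rpow hq.ne', sub_zero]
    field_simp
  have hms : MeasurableSet {t : ℝ | ENNReal.ofReal t < g} :=
    measurableSet_lt (by fun_prop) measurable_const
  rw [setLIntegral_indicator hms]
  by_cases hg : g = ∞
  · subst hg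
    rw [ENNReal.top_rpow_of_pos hq]
    symm
    refine ENNReal.eq_top_of_forall_nnreal_le fun r => ?_
    have h1 : ((r ^ q⁻¹ : NNReal) : ℝ≥0∞) ^ q = r := by
      rw [← ENNReal.coe_rpow_of_nonneg _ hq.le, ← NNReal.rpow_mul, inv_mul_cancel₀ hq.ne',
        NNReal.rpow_one]
    rw [← h1, ← ENNReal.ofReal_coe_nnreal, ← key _ (NNReal.coe_nonneg _)]
    exact lintegral_mono_set fun t ht => ⟨by simp, ht.1⟩
  · lift g to NNReal using hg
    rw [← ENNReal.ofReal_coe_nnreal, ← key _ g.coe_nonneg, restrict_Ioo_eq_restrict_Ioc.symm]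
    congr 2
    ext t
    simp only [mem_Ioo, mem_inter_iff, mem_ofPred_eq, mem_Ioi]
    constructor
    · rintro ⟨h1, h2⟩
      exact ⟨(ENNReal.ofReal_lt_ofReal_iff (h1.trans h2)).2 h2, h1⟩
    · rintro ⟨h1, h2⟩
      exact ⟨h2, ((ENNReal.ofReal_lt_ofReal_iff_of_nonneg h2.le).1 h1)⟩

open Module in
/-- The maximal function of aperture `a` is bounded on `L^q`. -/
lemma lintegral_tentMaximal_rpow_le {a : ℝ} (ha : 1 ≤ a) {f : E → ℝ≥0∞} (hf : Measurable f)
    {q : ℝ} (hq : 1 < q) :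
    ∫⁻ x, tentMaximal μ a f x ^ q ∂μ ≤
      ENNReal.ofReal ((5 * a) ^ finrank ℝ E * (2 ^ q * q / (q - 1))) * ∫⁻ x, f x ^ q ∂μ := by
  have hq0 : 0 < q := by linarith
  have hq1 : 0 < q - 1 := by linarith
  obtain ⟨D, hD⟩ : ∃ D, D = ENNReal.ofReal ((5 * a) ^ finrank ℝ E) := ⟨_, rfl⟩
  have hM : Measurable (tentMaximal μ a f) := (lowerSemicontinuous_tentMaximal μ a f).measurable
  calc ∫⁻ x, tentMaximal μ a f x ^ q ∂μ
      = ∫⁻ x, (∫⁻ t in Ioi (0 : ℝ), {t : ℝ | ENNReal.ofReal t < tentMaximal μ a f x}.indicator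
          (fun t => ENNReal.ofReal (q * t ^ (q - 1))) t) ∂μ := by
        simp_rw [← ennreal_rpow_eq_lintegral hq0]
    _ = ∫⁻ t in Ioi (0 : ℝ), ∫⁻ x, {t : ℝ | ENNReal.ofReal t < tentMaximal μ a f x}.indicator
          (fun t => ENNReal.ofReal (q * t ^ (q - 1))) t ∂μ := by
        refine lintegral_lintegral_swap (Measurable.aemeasurable ?_)
        have : Function.uncurry (fun (x : E) (t : ℝ) =>
            {t : ℝ | ENNReal.ofReal t < tentMaximal μ a f x}.indicator
              (fun t => ENNReal.ofReal (q * t ^ (q - 1))) t) =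
            {z : E × ℝ | ENNReal.ofReal z.2 < tentMaximal μ a f z.1}.indicator
              (fun z => ENNReal.ofReal (q * z.2 ^ (q - 1))) := by
          ext z; rfl
        rw [this]
        exact Measurable.indicator (by fun_prop)
          (measurableSet_lt (by fun_prop) (hM.comp measurable_fst))
    -- The truncated weak bound at height `t / 2` brings a factor `2 / t`, turning the density `q
    -- t^{q-1}` into a multiple of `(q-1) t^{q-2}`. After swapping the integrals, the layer-cake
    -- formula with exponent `q - 1` applies to `2 * f x`.
    _ ≤ ∫⁻ t in Ioi (0 : ℝ), ∫⁻ x, D * ENNReal.ofReal (2 * q / (q - 1)) * (f x *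
          {t : ℝ | ENNReal.ofReal t < 2 * f x}.indicator
            (fun t => ENNReal.ofReal ((q - 1) * t ^ (q - 1 - 1))) t) ∂μ := by
        refine setLIntegral_mono' measurableSet_Ioi fun t (ht : 0 < t) => ?_
        have h2 : (2 : ℝ≥0∞) * ENNReal.ofReal (t / 2) = ENNReal.ofReal t := by
          rw [← ENNReal.ofReal_ofNat 2, ← ENNReal.ofReal_mul (by norm_num)]
          congr 1
          ring
        have hw := measure_lt_tentMaximal_le_setLIntegral μ ha hf (l := ENNReal.ofReal (t / 2))
          (by simpa using ht) ENNReal.ofReal_ne_top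
        rw [h2] at hw
        have h3 (x : E) : {t : ℝ | ENNReal.ofReal t < tentMaximal μ a f x}.indicator
            (fun t => ENNReal.ofReal (q * t ^ (q - 1))) t =
            {x | ENNReal.ofReal t < tentMaximal μ a f x}.indicator
              (fun _ => ENNReal.ofReal (q * t ^ (q - 1))) x := rfl
        have hset : {z | ENNReal.ofReal (t / 2) < f z} = {z | ENNReal.ofReal t < 2 * f z} := by
          ext z
          simp only [mem_ofPred_eq]
          rw [← h2, ENNReal.mul_lt_mul_iff_right two_ne_zero ENNReal.ofNat_ne_top]
        have hms : MeasurableSet {z | ENNReal.ofReal t < 2 * f z} :=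
          measurableSet_lt measurable_const (by fun_prop)
        have h4 (x : E) : f x * {t : ℝ | ENNReal.ofReal t < 2 * f x}.indicator
            (fun t => ENNReal.ofReal ((q - 1) * t ^ (q - 1 - 1))) t =
            ENNReal.ofReal ((q - 1) * t ^ (q - 1 - 1)) *
              {z | ENNReal.ofReal t < 2 * f z}.indicator f x := by
          by_cases h : ENNReal.ofReal t < 2 * f x
          · rw [indicator_of_mem (by exact h), indicator_of_mem (by exact h), mul_comm]
          · rw [indicator_of_notMem (by exact h), indicator_of_notMem (by exact h), mul_zero,
              mul_zero]
        simp_rw [h3, h4]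
        rw [lintegral_indicator_const (measurableSet_lt measurable_const hM),
          lintegral_const_mul _ (by fun_prop (disch := assumption)),
          lintegral_const_mul _ (by fun_prop (disch := assumption)), lintegral_indicator hms,
          ← hset]
        rw [← hD, ← ENNReal.ofReal_inv_of_pos (by positivity)] at hw
        refine (mul_le_mul_right hw _).trans (le_of_eq ?_)
        set I := ∫⁻ z in {z | ENNReal.ofReal (t / 2) < f z}, f z ∂μ
        rw [show ∀ A B : ℝ≥0∞, A * (D * (B * I)) = D * (A * B) * I by intros; ring,
          show ∀ A B : ℝ≥0∞, D * A * (B * I) = D * (A * B) * I by intros; ring,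
          ← ENNReal.ofReal_mul (by positivity), ← ENNReal.ofReal_mul (by positivity)]
        congr 3
        rw [Real.rpow_sub_one ht.ne' (q - 1)]
        field_simp
    _ = ∫⁻ x, (∫⁻ t in Ioi (0 : ℝ), D * ENNReal.ofReal (2 * q / (q - 1)) * (f x *
          {t : ℝ | ENNReal.ofReal t < 2 * f x}.indicator
            (fun t => ENNReal.ofReal ((q - 1) * t ^ (q - 1 - 1))) t)) ∂μ := by
        refine (lintegral_lintegral_swap (Measurable.aemeasurable ?_)).symm
        have : Function.uncurry (fun (x : E) (t : ℝ) =>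
            D * ENNReal.ofReal (2 * q / (q - 1)) * (f x *
            {t : ℝ | ENNReal.ofReal t < 2 * f x}.indicator
              (fun t => ENNReal.ofReal ((q - 1) * t ^ (q - 1 - 1))) t)) =
            fun z : E × ℝ => D * ENNReal.ofReal (2 * q / (q - 1)) * (f z.1 *
            {z : E × ℝ | ENNReal.ofReal z.2 < 2 * f z.1}.indicator
              (fun z => ENNReal.ofReal ((q - 1) * z.2 ^ (q - 1 - 1))) z) := by
          ext z; rfl
        rw [this]
        refine Measurable.const_mul (Measurable.mul (by fun_prop) ?_) _
        exact Measurable.indicator (by fun_prop)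
          (measurableSet_lt (by fun_prop) (by fun_prop))
    _ = ∫⁻ x, D * ENNReal.ofReal (2 * q / (q - 1)) * (f x * (2 * f x) ^ (q - 1)) ∂μ := by
        refine lintegral_congr fun x => ?_
        have hms : MeasurableSet {t : ℝ | ENNReal.ofReal t < 2 * f x} :=
          measurableSet_lt (by fun_prop) measurable_const
        rw [lintegral_const_mul, lintegral_const_mul, ← ennreal_rpow_eq_lintegral hq1]
        · exact Measurable.indicator (by fun_prop) hms
        · exact (Measurable.indicator (by fun_prop) hms).const_mul _
    _ = ∫⁻ x, D * ENNReal.ofReal (2 * q / (q - 1)) * ENNReal.ofReal (2 ^ (q - 1)) * f x ^ q ∂μ := by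
        refine lintegral_congr fun x => ?_
        rw [ENNReal.mul_rpow_of_nonneg _ _ hq1.le, mul_assoc (D * _), mul_left_comm (f x)]
        congr 2
        · rw [← ENNReal.ofReal_rpow_of_pos two_pos, ENNReal.ofReal_ofNat]
        · nth_rw 1 [← ENNReal.rpow_one (f x)]
          rw [← ENNReal.rpow_add_of_nonneg _ _ zero_le_one hq1.le]
          congr 1
          ring
    _ = _ := by
        rw [lintegral_const_mul _ (by fun_prop)]
        congr 1
        rw [hD, ← ENNReal.ofReal_mul (by positivity), ← ENNReal.ofReal_mul (by positivity)]
        congr 1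
        rw [Real.rpow_sub_one two_ne_zero]
        ring

open Module in
/-- The maximal function of aperture `a` is bounded on `L^p` with norm `O(a ^ (d / p))`. -/
theorem exists_eLpNorm_tentMaximal_le {p : ℝ≥0∞} (hp : 1 < p) :
    ∃ C : ℝ, 0 < C ∧ ∀ a : ℝ, 1 ≤ a → ∀ f : E → ℝ≥0∞, AEMeasurable f μ →
      eLpNorm (tentMaximal μ a f) p μ ≤
        ENNReal.ofReal (C * a ^ ((finrank ℝ E : ℝ) / p.toReal)) * eLpNorm f p μ := by
  suffices h : ∃ C : ℝ, 0 < C ∧ ∀ a : ℝ, 1 ≤ a → ∀ f : E → ℝ≥0∞, Measurable f →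
      eLpNorm (tentMaximal μ a f) p μ ≤
        ENNReal.ofReal (C * a ^ ((finrank ℝ E : ℝ) / p.toReal)) * eLpNorm f p μ by
    obtain ⟨C, hC, h⟩ := h
    refine ⟨C, hC, fun a ha f hf => ?_⟩
    rw [tentMaximal_congr_ae a hf.ae_eq_mk, eLpNorm_congr_ae hf.ae_eq_mk]
    exact h a ha _ hf.measurable_mk
  by_cases hp' : p = ∞
  -- Averages never exceed the essential supremum; as `∞.toReal = 0`, the power of `a` is `a ^ 0 =
  -- 1`.
  · refine ⟨1, one_pos, fun a ha f hf => ?_⟩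
    subst hp'
    simp only [ENNReal.toReal_top, div_zero, Real.rpow_zero, mul_one, ENNReal.ofReal_one, one_mul,
      eLpNorm_exponent_top, eLpNormEssSup, enorm_eq_self]
    refine essSup_le_of_ae_le _ (Filter.Eventually.of_forall fun x => ?_)
    refine iSup_le fun y => iSup_le fun r => iSup_le fun h => ?_
    refine (mul_le_mul_right (lintegral_mono_ae
      ((ae_restrict_of_ae (ENNReal.ae_le_essSup f)))) _).trans ?_
    simp only [lintegral_const, Measure.restrict_apply MeasurableSet.univ, univ_inter]
    rw [mul_left_comm]
    exact mul_le_of_le_one_right' (ENNReal.inv_mul_le_one _)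
  · have hq : 1 < p.toReal := by
      rw [← ENNReal.toReal_one]
      exact (ENNReal.toReal_lt_toReal ENNReal.one_ne_top hp').2 hp
    have hp0 : p ≠ 0 := (zero_lt_one.trans hp).ne'
    set q := p.toReal
    have hq0 : 0 < q := by linarith
    have hq1 : 0 < q - 1 := by linarith
    refine ⟨(5 ^ finrank ℝ E * (2 ^ q * q / (q - 1))) ^ (1 / q), by positivity,
      fun a ha f hf => ?_⟩
    rw [eLpNorm_eq_lintegral_rpow_enorm_toReal hp0 hp',
      eLpNorm_eq_lintegral_rpow_enorm_toReal hp0 hp']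
    simp only [enorm_eq_self]
    refine (ENNReal.rpow_le_rpow (lintegral_tentMaximal_rpow_le μ ha hf hq)
      (by positivity)).trans (le_of_eq ?_)
    rw [ENNReal.mul_rpow_of_nonneg _ _ (by positivity),
      ENNReal.ofReal_rpow_of_nonneg (by positivity) (by positivity)]
    congr 2
    have : (5 * a) ^ finrank ℝ E * (2 ^ q * q / (q - 1)) =
      (5 ^ finrank ℝ E * (2 ^ q * q / (q - 1))) * a ^ finrank ℝ E := by ring
    rw [this, Real.mul_rpow (by positivity) (by positivity), ← Real.rpow_natCast a,
      ← Real.rpow_mul (by positivity)]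
    congr 2
    ring

end Maximal

/-! ### Convolution of slowly growing functions with Schwartz functions. -/

section WeightedIntegrable

variable {n : ℕ}

lemma one_add_norm_le_mul {E : Type*} [SeminormedAddCommGroup E] (x y : E) :
    1 + ‖y‖ ≤ (1 + ‖x‖) * (1 + ‖x - y‖) := by
  have h1 : ‖y‖ ≤ ‖x‖ + ‖x - y‖ := by
    simpa using norm_sub_le x (x - y)
  nlinarith [norm_nonneg x, norm_nonneg (x - y), mul_nonneg (norm_nonneg x) (norm_nonneg (x - y))]

lemma integrable_inv_one_add_norm_pow :
    Integrable (fun y : Rn n => ((1 + ‖y‖) ^ (n + 1))⁻¹) := by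
  have h := integrable_one_add_norm (E := Rn n) (μ := volume) (r := (n + 1 : ℕ))
    (by simp)
  refine h.congr (Filter.Eventually.of_forall fun y => ?_)
  simp only
  rw [Real.rpow_neg (by positivity), Real.rpow_natCast]

lemma exists_norm_le_inv_one_add_norm_pow (g : 𝓢(Rn n, ℂ)) (k : ℕ) :
    ∃ B : ℝ, 0 ≤ B ∧ ∀ x, ‖g x‖ ≤ B * ((1 + ‖x‖) ^ k)⁻¹ := by
  refine ⟨2 ^ k * (Finset.Iic (k, 0)).sup (fun m => SchwartzMap.seminorm ℝ m.1 m.2) g,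
    by positivity, fun x => ?_⟩
  have h := SchwartzMap.one_add_le_sup_seminorm_apply (𝕜 := ℝ) (m := (k, 0)) le_rfl le_rfl g x
  rw [norm_iteratedFDeriv_zero] at h
  rw [← div_eq_mul_inv, le_div_iff₀ (by positivity), mul_comm]
  exact h

/-- Functions that are integrable against the weight `(1 + ‖y‖) ^ (-(n + 1))`. -/
def WeightedIntegrable (f : Rn n → ℂ) : Prop :=
  Integrable fun y => ((((1 + ‖y‖) ^ (n + 1))⁻¹ : ℝ) : ℂ) * f y

/-- For finite `p`, the weight `w ≤ 1` is integrable and `w |f| ≤ w + |f|^p`, by comparing `|f|`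
with 1. The pointwise argument can therefore run in one class containing all the `L^p`. -/
lemma weightedIntegrable_of_memLp {p : ℝ≥0∞} (hp : 1 ≤ p) {f : Rn n → ℂ}
    (hf : MemLp f p volume) : WeightedIntegrable f := by
  have hw := (integrable_inv_one_add_norm_pow (n := n))
  have hmeas : AEStronglyMeasurable
      (fun y : Rn n => ((((1 + ‖y‖) ^ (n + 1))⁻¹ : ℝ) : ℂ) * f y) volume :=
    (Complex.continuous_ofReal.comp_aestronglyMeasurable hw.1).mul hf.1
  have hnorm (y : Rn n) : ‖((((1 + ‖y‖) ^ (n + 1))⁻¹ : ℝ) : ℂ) * f y‖ =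
      ((1 + ‖y‖) ^ (n + 1))⁻¹ * ‖f y‖ := by
    rw [norm_mul, Complex.norm_real, Real.norm_of_nonneg (by positivity)]
  by_cases hp' : p = ∞
  · subst hp'
    have hb : ∀ᵐ y, ‖f y‖ ≤ (eLpNorm f ∞ volume).toReal := by
      filter_upwards [ae_le_eLpNormEssSup (f := f) (μ := volume)] with y hy
      rw [← eLpNorm_exponent_top, ← ofReal_norm] at hy
      exact (ENNReal.ofReal_le_iff_le_toReal hf.2.ne).1 hy
    refine (hw.mul_const (eLpNorm f ∞ volume).toReal).mono' hmeas ?_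
    filter_upwards [hb] with y hy
    rw [hnorm]
    gcongr
  · have hp1 : 1 ≤ p.toReal := by
      rw [← ENNReal.toReal_one]
      exact ENNReal.toReal_mono hp' hp
    have hi := hf.integrable_norm_rpow (zero_lt_one.trans_le hp).ne' hp'
    refine (hw.add hi).mono' hmeas (Filter.Eventually.of_forall fun y => ?_)
    rw [hnorm, Pi.add_apply]
    have hw0 : 0 ≤ ((1 + ‖y‖) ^ (n + 1))⁻¹ := by positivity
    have hw1 : ((1 + ‖y‖) ^ (n + 1))⁻¹ ≤ 1 :=
      inv_le_one_of_one_le₀ (one_le_pow₀ (by linarith [norm_nonneg y]))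
    have h0 : 0 ≤ ‖f y‖ ^ p.toReal := by positivity
    rcases le_total ‖f y‖ 1 with h | h
    · nlinarith [mul_le_mul_of_nonneg_left h hw0]
    · have : ‖f y‖ ≤ ‖f y‖ ^ p.toReal := Real.self_le_rpow_of_one_le h hp1
      nlinarith [mul_le_mul_of_nonneg_right hw1 (norm_nonneg (f y))]

/-- The weights at `u` and at `x + t • A u` differ by a factor at most `((1 + ‖x‖)(1 + t))^(n+1)`.
This permits the reduction to the origin, `t = 1` and `A = 1`. -/
lemma WeightedIntegrable.comp_similarity {f : Rn n → ℂ} (hf : WeightedIntegrable f) (x : Rn n)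
    {t : ℝ} (ht : 0 < t) (A : Rn n ≃ₗᵢ[ℝ] Rn n) :
    WeightedIntegrable fun u => f (x + t • A u) := by
  have h1 := hf.comp_add_left x
  have h2 := h1.comp_smul ht.ne'
  have h3 := (A.measurePreserving.integrable_comp_emb
    A.toHomeomorph.measurableEmbedding).2 h2
  have h4 : Integrable (fun u => ((((1 + ‖u‖) ^ (n + 1))⁻¹ * (1 + ‖x + t • A u‖) ^ (n + 1) : ℝ) : ℂ)
      * (((((1 + ‖x + t • A u‖) ^ (n + 1))⁻¹ : ℝ) : ℂ) * f (x + t • A u))) := by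
    refine h3.bdd_mul (c := ((1 + ‖x‖) * (1 + t)) ^ (n + 1)) ?_
      (Filter.Eventually.of_forall fun u => ?_)
    · refine Continuous.aestronglyMeasurable (Complex.continuous_ofReal.comp ?_)
      refine Continuous.mul (Continuous.inv₀ (by fun_prop) fun u => by positivity) (by fun_prop)
    · rw [Complex.norm_real, Real.norm_of_nonneg (by positivity), inv_mul_eq_div,
        div_le_iff₀ (by positivity), ← mul_pow]
      refine pow_le_pow_left₀ (by positivity) ?_ _
      have := norm_add_le x (t • A u)
      rw [norm_smul, Real.norm_of_nonneg ht.le, A.norm_map] at this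
      have h0 := norm_nonneg x
      have h0' := norm_nonneg u
      nlinarith [mul_nonneg h0 h0', mul_nonneg h0 ht.le, mul_nonneg h0' ht.le,
        mul_nonneg (mul_nonneg h0 h0') ht.le]
  refine h4.congr (Filter.Eventually.of_forall fun u => ?_)
  simp only
  rw [← mul_assoc, ← Complex.ofReal_mul, mul_assoc, mul_inv_cancel₀ (by positivity), mul_one]

lemma conv_eq_integral_sub (f g : Rn n → ℂ) (x : Rn n) :
    conv f g x = ∫ y, f y * g (x - y) := by
  rw [conv, ← integral_sub_left_eq_self _ volume x]
  simp

variable {f : Rn n → ℂ} (hf : WeightedIntegrable f) (g : 𝓢(Rn n, ℂ))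

lemma norm_one_add_pow_mul_le {B : ℝ} {g : Rn n → ℂ}
    (hg : ∀ y, ‖g y‖ ≤ B * ((1 + ‖y‖) ^ (n + 1))⁻¹) (x y : Rn n) :
    ‖(((1 + ‖y‖) ^ (n + 1) : ℝ) : ℂ) * g (x - y)‖ ≤ B * (1 + ‖x‖) ^ (n + 1) := by
  rw [norm_mul, Complex.norm_real, Real.norm_of_nonneg (by positivity)]
  calc (1 + ‖y‖) ^ (n + 1) * ‖g (x - y)‖
      ≤ ((1 + ‖x‖) * (1 + ‖x - y‖)) ^ (n + 1) * (B * ((1 + ‖x - y‖) ^ (n + 1))⁻¹) := by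
        gcongr
        · exact one_add_norm_le_mul x y
        · exact hg _
    _ = B * (1 + ‖x‖) ^ (n + 1) := by
        rw [mul_pow]
        field_simp

include hf in
lemma WeightedIntegrable.integrable_mul_sub (x : Rn n) :
    Integrable fun y => f y * g (x - y) := by
  obtain ⟨B, hB, hg⟩ := exists_norm_le_inv_one_add_norm_pow g (n + 1)
  have h : Integrable (fun y => ((((1 + ‖y‖) ^ (n + 1) : ℝ) : ℂ) * g (x - y)) *
      (((((1 + ‖y‖) ^ (n + 1))⁻¹ : ℝ) : ℂ) * f y)) := by
    refine Integrable.bdd_mul hf (c := B * (1 + ‖x‖) ^ (n + 1)) ?_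
      (Filter.Eventually.of_forall fun y => norm_one_add_pow_mul_le hg x y)
    have := g.continuous
    exact Continuous.aestronglyMeasurable (by fun_prop)
  refine h.congr (Filter.Eventually.of_forall fun y => ?_)
  have : (((1 + ‖y‖) ^ (n + 1) : ℝ) : ℂ) ≠ 0 := by
    exact_mod_cast (by positivity : (1 + ‖y‖) ^ (n + 1) ≠ 0)
  simp only [Complex.ofReal_inv]
  field_simp

include hf in
lemma WeightedIntegrable.integrable_sub_mul (x : Rn n) :
    Integrable fun y => f (x - y) * g y := by
  simpa using (hf.integrable_mul_sub g x).comp_sub_left x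

include hf in
lemma WeightedIntegrable.conv_add (g h : 𝓢(Rn n, ℂ)) (x : Rn n) :
    conv f (g + h) x = conv f g x + conv f h x := by
  simp only [conv, Pi.add_apply, mul_add]
  exact integral_add (hf.integrable_sub_mul g x) (hf.integrable_sub_mul h x)

include hf in
lemma WeightedIntegrable.exists_norm_conv_le :
    ∃ B : ℝ, 0 ≤ B ∧ ∀ x, ‖conv f g x‖ ≤ B * (1 + ‖x‖) ^ (n + 1) := by
  obtain ⟨B, hB, hg⟩ := exists_norm_le_inv_one_add_norm_pow g (n + 1)
  refine ⟨B * ∫ y, ‖((((1 + ‖y‖) ^ (n + 1))⁻¹ : ℝ) : ℂ) * f y‖,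
    mul_nonneg hB (integral_nonneg fun _ => norm_nonneg _), fun x => ?_⟩
  rw [conv_eq_integral_sub, mul_right_comm, ← integral_const_mul]
  refine norm_integral_le_of_norm_le (hf.norm.const_mul _)
    (Filter.Eventually.of_forall fun y => ?_)
  refine le_trans (le_of_eq ?_) (mul_le_mul_of_nonneg_right
    (norm_one_add_pow_mul_le hg x y) (norm_nonneg _))
  rw [← norm_mul]
  have : (((1 + ‖y‖) ^ (n + 1) : ℝ) : ℂ) ≠ 0 := by
    exact_mod_cast (by positivity : (1 + ‖y‖) ^ (n + 1) ≠ 0)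
  simp only [Complex.ofReal_inv]
  congr 1
  field_simp

include hf in
lemma WeightedIntegrable.continuous_conv : Continuous (conv f g) := by
  obtain ⟨B, hB, hg⟩ := exists_norm_le_inv_one_add_norm_pow g (n + 1)
  have hgc := g.continuous
  rw [continuous_iff_continuousAt]
  intro x
  simp only [funext (conv_eq_integral_sub f g)]
  refine continuousAt_of_dominated (bound := fun y => B * (2 + ‖x‖) ^ (n + 1) *
    ‖((((1 + ‖y‖) ^ (n + 1))⁻¹ : ℝ) : ℂ) * f y‖) ?_ ?_ (hf.norm.const_mul _) ?_
  · exact Filter.Eventually.of_forall fun x => (hf.integrable_mul_sub g x).1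
  · filter_upwards [Metric.ball_mem_nhds x one_pos] with x' hx'
    refine Filter.Eventually.of_forall fun y => ?_
    have h1 : 1 + ‖x'‖ ≤ 2 + ‖x‖ := by
      have := norm_le_norm_add_norm_sub' x' x
      rw [Metric.mem_ball, dist_eq_norm] at hx'
      linarith
    have h2 : B * (1 + ‖x'‖) ^ (n + 1) ≤ B * (2 + ‖x‖) ^ (n + 1) := by gcongr
    refine le_trans (le_of_eq ?_) (mul_le_mul_of_nonneg_right
      ((norm_one_add_pow_mul_le hg x' y).trans h2) (norm_nonneg _))
    rw [← norm_mul]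
    have : (((1 + ‖y‖) ^ (n + 1) : ℝ) : ℂ) ≠ 0 := by
      exact_mod_cast (by positivity : (1 + ‖y‖) ^ (n + 1) ≠ 0)
    simp only [Complex.ofReal_inv]
    congr 1
    field_simp
  · exact Filter.Eventually.of_forall fun y => by fun_prop

/-- Convolution of Schwartz functions. -/
noncomputable def sconv (a b : 𝓢(Rn n, ℂ)) : 𝓢(Rn n, ℂ) :=
  SchwartzMap.convolution (ContinuousLinearMap.mul ℂ ℂ) a b

lemma sconv_apply (a b : 𝓢(Rn n, ℂ)) (x : Rn n) : sconv a b x = conv a b x := by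
  rw [sconv, SchwartzMap.convolution_apply, conv_eq_integral_sub]
  rfl

lemma fourier_sconv (a b : 𝓢(Rn n, ℂ)) (ξ : Rn n) :
    𝓕 (sconv a b) ξ = 𝓕 a ξ * 𝓕 b ξ := by
  rw [sconv, SchwartzMap.fourier_convolution]
  rfl

include hf in
lemma WeightedIntegrable.conv_conv (a b : 𝓢(Rn n, ℂ)) (x : Rn n) :
    conv (conv f a) b x = conv f (sconv a b) x := by
  obtain ⟨B, hB, ha⟩ := exists_norm_le_inv_one_add_norm_pow a (n + 1)
  -- Half of this decay makes the integrand summable in `y`; the other half pays for shifting the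
  -- weight of `f` from `u` to `x - y - u`.
  obtain ⟨B', hB', hb⟩ := exists_norm_le_inv_one_add_norm_pow b (n + 1 + (n + 1))
  have hac := a.continuous
  have hbc := b.continuous
  have hint : Integrable (Function.uncurry fun y u : Rn n => f u * a (x - y - u) * b y)
      (volume.prod volume) := by
    have h0 : Integrable (fun z : Rn n × Rn n => ((((1 + ‖z.1‖) ^ (n + 1))⁻¹ : ℝ) : ℂ) *
        (((((1 + ‖z.2‖) ^ (n + 1))⁻¹ : ℝ) : ℂ) * f z.2)) (volume.prod volume) :=
      Integrable.mul_prod (integrable_inv_one_add_norm_pow (n := n)).ofReal hf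
    have h : Integrable (fun z : Rn n × Rn n =>
        ((((1 + ‖z.1‖) ^ (n + 1) * (1 + ‖z.2‖) ^ (n + 1) : ℝ) : ℂ) *
          (a (x - z.1 - z.2) * b z.1)) *
        (((((1 + ‖z.1‖) ^ (n + 1))⁻¹ : ℝ) : ℂ) *
        (((((1 + ‖z.2‖) ^ (n + 1))⁻¹ : ℝ) : ℂ) * f z.2))) (volume.prod volume) := by
      refine Integrable.bdd_mul h0 (c := B * B' * (1 + ‖x‖) ^ (n + 1)) ?_
        (Filter.Eventually.of_forall fun z => ?_)
      · exact Continuous.aestronglyMeasurable (by fun_prop)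
      · rw [norm_mul, norm_mul, Complex.norm_real, Real.norm_of_nonneg (by positivity)]
        have h1 := one_add_norm_le_mul (x - z.1) z.2
        have h2 : 1 + ‖x - z.1‖ ≤ (1 + ‖x‖) * (1 + ‖z.1‖) := by
          have := norm_sub_le x z.1
          nlinarith [mul_nonneg (norm_nonneg x) (norm_nonneg z.1)]
        have h3 : 1 + ‖z.2‖ ≤ (1 + ‖x‖) * (1 + ‖z.1‖) * (1 + ‖x - z.1 - z.2‖) :=
          h1.trans (by gcongr)
        calc (1 + ‖z.1‖) ^ (n + 1) * (1 + ‖z.2‖) ^ (n + 1) * (‖a (x - z.1 - z.2)‖ * ‖b z.1‖)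
            ≤ (1 + ‖z.1‖) ^ (n + 1) *
              ((1 + ‖x‖) * (1 + ‖z.1‖) * (1 + ‖x - z.1 - z.2‖)) ^ (n + 1) *
              ((B * ((1 + ‖x - z.1 - z.2‖) ^ (n + 1))⁻¹) *
                (B' * ((1 + ‖z.1‖) ^ (n + 1 + (n + 1)))⁻¹)) := by
              gcongr
              · exact ha _
              · exact hb _
          _ = B * B' * (1 + ‖x‖) ^ (n + 1) := by
              rw [mul_pow, mul_pow]
              field_simp
              ring
    refine h.congr (Filter.Eventually.of_forall fun z => ?_)
    have h1 : (((1 + ‖z.1‖) ^ (n + 1) : ℝ) : ℂ) ≠ 0 := by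
      exact_mod_cast (by positivity : (1 + ‖z.1‖) ^ (n + 1) ≠ 0)
    have h2 : (((1 + ‖z.2‖) ^ (n + 1) : ℝ) : ℂ) ≠ 0 := by
      exact_mod_cast (by positivity : (1 + ‖z.2‖) ^ (n + 1) ≠ 0)
    simp only [Complex.ofReal_inv, Complex.ofReal_mul, Function.uncurry]
    field_simp
  calc conv (conv f a) b x = ∫ y, ∫ u, f u * a (x - y - u) * b y := by
        simp only [conv]
        refine integral_congr_ae (Filter.Eventually.of_forall fun y => ?_)
        simp only
        rw [integral_mul_const, ← conv_eq_integral_sub]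
        rfl
    _ = ∫ u, ∫ y, f u * a (x - y - u) * b y := integral_integral_swap hint
    _ = ∫ u, f u * sconv a b (x - u) := by
        refine integral_congr_ae (Filter.Eventually.of_forall fun u => ?_)
        simp only [sconv_apply, conv]
        rw [← integral_const_mul]
        refine integral_congr_ae (Filter.Eventually.of_forall fun y => ?_)
        simp only [mul_assoc]
        rw [sub_right_comm]
    _ = conv f (sconv a b) x := (conv_eq_integral_sub _ _ _).symm

end WeightedIntegrable

/-! ### Dilations and the approximate identity. -/

section Dilate

variable {n : ℕ}

lemma integral_dilate_isometry {t : ℝ} (ht : 0 < t) (A : Rn n ≃ₗᵢ[ℝ] Rn n) (h : Rn n → ℂ)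
    (g : Rn n → ℂ) :
    ∫ y, h y * dilate t g (A.symm y) = ∫ y, h (t • A y) * g y := by
  have h1 : ∫ y, h (t • A y) * g y = ∫ y, h (t • y) * g (A.symm y) := by
    rw [← A.measurePreserving.integral_comp A.toHomeomorph.measurableEmbedding
      (fun y => h (t • y) * g (A.symm y))]
    simp
  rw [h1]
  have h2 := Measure.integral_comp_smul_of_nonneg (volume : Measure (Rn n))
    (fun y => h y * dilate t g (A.symm y)) t (hR := ht.le)
  have h3 : (t ^ Module.finrank ℝ (Rn n))⁻¹ = (t ^ n)⁻¹ := by simp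
  have hne : (t ^ n)⁻¹ ≠ 0 := by positivity
  rw [h3] at h2
  have h4 : ∫ y, h (t • y) * dilate t g (A.symm (t • y)) =
      (t ^ n)⁻¹ • ∫ y, h (t • y) * g (A.symm y) := by
    rw [← integral_smul]
    refine integral_congr_ae (Filter.Eventually.of_forall fun y => ?_)
    simp only [dilate, map_smul, smul_smul, inv_mul_cancel₀ ht.ne', one_smul, Complex.real_smul]
    ring
  rw [h4] at h2
  exact (smul_right_injective ℂ hne h2).symm

lemma conv_dilate_isometry {t : ℝ} (ht : 0 < t) (A : Rn n ≃ₗᵢ[ℝ] Rn n) (f g : Rn n → ℂ)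
    (x : Rn n) :
    conv f (fun y => dilate t g (A.symm y)) x = ∫ y, f (x - t • A y) * g y :=
  integral_dilate_isometry ht A (fun y => f (x - y)) g

lemma conv_dilate {t : ℝ} (ht : 0 < t) (f g : Rn n → ℂ) (x : Rn n) :
    conv f (dilate t g) x = ∫ y, f (x - t • y) * g y :=
  conv_dilate_isometry ht (LinearIsometryEquiv.refl ℝ (Rn n)) f g x

lemma dilate_dilate (s t : ℝ) (g : Rn n → ℂ) : dilate s (dilate t g) = dilate (s * t) g := by
  ext x
  simp only [dilate, smul_smul, mul_inv, mul_pow, Complex.ofReal_mul, mul_comm t⁻¹, mul_assoc]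

/-- The dilation `g_t` of a Schwartz function, as a Schwartz function (equal to `g` if `t = 0`). -/
noncomputable def sdilate (t : ℝ) (g : 𝓢(Rn n, ℂ)) : 𝓢(Rn n, ℂ) :=
  if ht : t = 0 then g else
    (((t ^ n)⁻¹ : ℝ) : ℂ) • SchwartzMap.compCLMOfContinuousLinearEquiv ℂ
      (ContinuousLinearEquiv.smulLeft (M₁ := Rn n) (R₁ := ℝ) (Units.mk0 t⁻¹ (inv_ne_zero ht))) g

lemma coe_sdilate {t : ℝ} (ht : t ≠ 0) (g : 𝓢(Rn n, ℂ)) :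
    (sdilate t g : Rn n → ℂ) = dilate t g := by
  ext x
  simp only [sdilate, dif_neg ht]
  rfl

lemma fourier_sdilate {t : ℝ} (ht : 0 < t) (g : 𝓢(Rn n, ℂ)) (ξ : Rn n) :
    𝓕 (sdilate t g) ξ = 𝓕 g (t • ξ) := by
  rw [SchwartzMap.fourier_coe, SchwartzMap.fourier_coe, coe_sdilate ht.ne', Real.fourier_eq',
    Real.fourier_eq']
  have := integral_dilate_isometry ht (LinearIsometryEquiv.refl ℝ (Rn n))
    (fun v => Complex.exp ((-2 * Real.pi * inner ℝ v ξ : ℝ) * Complex.I)) g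
  simp only [smul_eq_mul]
  refine this.trans (integral_congr_ae (Filter.Eventually.of_forall fun y => ?_))
  simp only [LinearIsometryEquiv.coe_refl, id, inner_smul_left, inner_smul_right]
  rfl

/-- Dilations of a Schwartz function of integral one are an approximate identity. -/
lemma WeightedIntegrable.tendsto_conv_conv_dilate {f : Rn n → ℂ} (hf : WeightedIntegrable f)
    (K φ : 𝓢(Rn n, ℂ)) (hφ : ∫ y, φ y = 1) {s : ℕ → ℝ} (hs : ∀ k, 0 < s k) (hs1 : ∀ k, s k ≤ 1)
    (hlim : Filter.Tendsto s Filter.atTop (nhds 0)) :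
    Filter.Tendsto (fun k => conv (conv f K) (dilate (s k) φ) 0) Filter.atTop
      (nhds (conv f K 0)) := by
  obtain ⟨B, hB, hgrow⟩ := hf.exists_norm_conv_le K
  obtain ⟨B', hB', hdec⟩ := exists_norm_le_inv_one_add_norm_pow φ (n + 1 + (n + 1))
  have hc := hf.continuous_conv K
  have hφc := φ.continuous
  have : conv f K 0 = ∫ y, conv f K 0 * φ y := by
    rw [integral_const_mul, hφ, mul_one]
  rw [this]
  simp only [conv_dilate (hs _), zero_sub]
  refine tendsto_integral_of_dominated_convergence
    (fun y => B * B' * ((1 + ‖y‖) ^ (n + 1))⁻¹) ?_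
    (integrable_inv_one_add_norm_pow.const_mul _) ?_ ?_
  · exact fun k => Continuous.aestronglyMeasurable (by fun_prop)
  · refine fun k => Filter.Eventually.of_forall fun y => ?_
    rw [norm_mul]
    have h1 : ‖-(s k • y)‖ ≤ ‖y‖ := by
      rw [norm_neg, norm_smul, Real.norm_of_nonneg (hs k).le]
      exact mul_le_of_le_one_left (norm_nonneg _) (hs1 k)
    calc ‖conv f K (-(s k • y))‖ * ‖φ y‖
        ≤ (B * (1 + ‖y‖) ^ (n + 1)) * (B' * ((1 + ‖y‖) ^ (n + 1 + (n + 1)))⁻¹) := by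
          gcongr
          · exact (hgrow _).trans (by gcongr)
          · exact hdec y
      _ = _ := by
          field_simp
          ring
  · refine Filter.Eventually.of_forall fun y => ?_
    refine Filter.Tendsto.mul_const _ ?_
    refine (hc.tendsto 0).comp ?_
    have := (hlim.smul_const y).neg
    simpa using this

end Dilate

/-! ### Frequency decomposition with the cutoff. -/

section Fourier

variable {n : ℕ}

lemma schwartz_fourier_injective {f g : 𝓢(Rn n, ℂ)} (h : ∀ ξ, 𝓕 f ξ = 𝓕 g ξ) : f = g := by
  have : 𝓕 f = 𝓕 g := SchwartzMap.ext h
  have h2 := congrArg (fun k : 𝓢(Rn n, ℂ) => (𝓕⁻ k : 𝓢(Rn n, ℂ))) this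
  simpa only [FourierTransform.fourierInv_fourier_eq] using h2

lemma fourier_iterate_lineDeriv (v : Rn n) (m : ℕ) (K : 𝓢(Rn n, ℂ)) (ξ : Rn n) :
    𝓕 ((fun h : 𝓢(Rn n, ℂ) => ∂_{v} h)^[m] K) ξ =
      (2 * Real.pi * Complex.I * (inner ℝ ξ v : ℝ)) ^ m * 𝓕 K ξ := by
  induction m with
  | zero => simp
  | succ m ih =>
    have ht : (inner ℝ · v : Rn n → ℝ).HasTemperateGrowth :=
      ((innerSL ℝ).flip v).hasTemperateGrowth
    rw [Function.iterate_succ_apply', SchwartzMap.fourier_lineDerivOp_eq, _root_.smul_apply,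
      SchwartzMap.smulLeftCLM_apply_apply ht, ih, pow_succ]
    simp only [smul_eq_mul, Complex.real_smul]
    ring

lemma IsCutoff.integral_eq_one {φ : 𝓢(Rn n, ℂ)} (hφ : IsCutoff φ) : ∫ y, φ y = 1 := by
  have := hφ.eq_one 0 (by simp)
  rw [SchwartzMap.fourier_coe, Real.fourier_eq'] at this
  simpa using this

lemma IsCutoff.apply_isometry {φ : 𝓢(Rn n, ℂ)} (hφ : IsCutoff φ) (A : Rn n ≃ₗᵢ[ℝ] Rn n)
    (x : Rn n) : φ (A x) = φ x := by
  have : SchwartzMap.compCLMOfContinuousLinearEquiv ℂ A.toContinuousLinearEquiv φ = φ := by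
    refine schwartz_fourier_injective fun ξ => ?_
    rw [← hφ.radial A ξ, SchwartzMap.fourier_coe, SchwartzMap.fourier_coe]
    exact Real.fourier_comp_linearIsometry A φ ξ
  exact DFunLike.congr_fun this x

/-- For `‖η‖ ≤ 2` the first factor is one; for `‖η‖ ≥ 2` both terms of the difference vanish. This
is what inserts a factor `φ_{s/2}` for free. -/
lemma IsCutoff.half_mul_sub {φ : 𝓢(Rn n, ℂ)} (hφ : IsCutoff φ) (η : Rn n) :
    𝓕 φ ((1 / 2 : ℝ) • η) * (𝓕 φ η - 𝓕 φ ((2 : ℝ) • η)) = 𝓕 φ η - 𝓕 φ ((2 : ℝ) • η) := by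
  rcases le_total ‖η‖ 2 with h | h
  · rw [hφ.eq_one, one_mul]
    rw [norm_smul]
    norm_num
    linarith
  · rw [hφ.eq_zero η h, hφ.eq_zero ((2 : ℝ) • η), sub_zero, mul_zero]
    rw [norm_smul]
    norm_num
    linarith

lemma IsCutoff.half_mul {φ : 𝓢(Rn n, ℂ)} (hφ : IsCutoff φ) (η : Rn n) :
    𝓕 φ ((1 / 2 : ℝ) • η) * 𝓕 φ η = 𝓕 φ η := by
  rcases le_total ‖η‖ 2 with h | h
  · rw [hφ.eq_one, one_mul]
    rw [norm_smul]
    norm_num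
    linarith
  · rw [hφ.eq_zero η h, mul_zero]

/-- The symbol `φ̂(η) - φ̂(2η)` is divisible by the symbol of `∑ ∂ᵢ ^ (2k)`, since it vanishes
near the origin. -/
lemma IsCutoff.exists_fourier_sub_eq {φ : 𝓢(Rn n, ℂ)} (hφ : IsCutoff φ) (k : ℕ) :
    ∃ Ψ : 𝓢(Rn n, ℂ), ∀ η : Rn n, 𝓕 φ η - 𝓕 φ ((2 : ℝ) • η) =
      (∑ i, (2 * Real.pi * Complex.I * (η i : ℝ)) ^ (2 * k)) * 𝓕 Ψ η := by
  set D : Rn n → ℝ := fun η => ∑ i, (2 * Real.pi * η i) ^ (2 * k) with hD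
  set χ : Rn n → ℂ := fun η => 𝓕 φ η - 𝓕 φ ((2 : ℝ) • η) with hχ
  have hDsmooth : ContDiff ℝ ⊤ D := by fun_prop
  have hχsmooth : ContDiff ℝ (⊤ : ℕ∞) χ := by
    have h1 := (𝓕 φ).smooth ⊤
    exact h1.sub (h1.comp (contDiff_const_smul 2))
  have hDpos : ∀ η : Rn n, η ≠ 0 → 0 < D η := by
    intro η hη
    obtain ⟨i, hi⟩ : ∃ i, η i ≠ 0 := by
      by_contra! h
      exact hη (by ext i; simpa using h i)
    refine Finset.sum_pos' (fun j _ => (even_two_mul k).pow_nonneg _) ⟨i, Finset.mem_univ _, ?_⟩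
    exact (even_two_mul k).pow_pos (mul_ne_zero (by positivity) hi)
  have hχ0 : ∀ η : Rn n, ‖η‖ ≤ 1 / 2 → χ η = 0 := by
    intro η hη
    simp only [hχ]
    rw [hφ.eq_one η (by linarith), hφ.eq_one, sub_self]
    rw [norm_smul]
    norm_num
    linarith
  -- Being a sum of even powers, `D` can vanish only at the origin, and `χ` is zero on a
  -- neighbourhood of it.
  have hsmooth : ContDiff ℝ (⊤ : ℕ∞) (fun η => (D η)⁻¹ • χ η) := by
    rw [contDiff_iff_contDiffAt]
    intro η
    by_cases hη : η = 0
    · subst hη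
      refine (contDiffAt_const (c := (0 : ℂ))).congr_of_eventuallyEq ?_
      filter_upwards [Metric.closedBall_mem_nhds (0 : Rn n) (by norm_num : (0 : ℝ) < 1 / 2)]
        with ξ hξ
      rw [hχ0 ξ (by simpa using hξ), smul_zero]
    · exact ((hDsmooth.of_le le_top).contDiffAt.inv (hDpos η hη).ne').smul hχsmooth.contDiffAt
  have hsupp : HasCompactSupport (fun η => (D η)⁻¹ • χ η) := by
    refine HasCompactSupport.intro (isCompact_closedBall (0 : Rn n) 2) fun η hη => ?_
    have h2 : 2 ≤ ‖η‖ := by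
      simp only [Metric.mem_closedBall, dist_zero_right, not_le] at hη
      exact hη.le
    simp only [hχ]
    rw [hφ.eq_zero η h2, hφ.eq_zero ((2 : ℝ) • η), sub_zero, smul_zero]
    rw [norm_smul]
    norm_num
    linarith
  -- The sign compensates `I ^ (2 * k)` in the symbol of the derivatives.
  refine ⟨((-1 : ℂ) ^ k) • 𝓕⁻ (hsupp.toSchwartzMap hsmooth), fun η => ?_⟩
  rw [FourierTransform.fourier_smul, FourierTransform.fourier_fourierInv_eq,
    _root_.smul_apply]
  have hsum : (∑ i, (2 * Real.pi * Complex.I * (η i : ℝ)) ^ (2 * k)) =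
      (-1 : ℂ) ^ k * (D η : ℂ) := by
    simp only [hD, Complex.ofReal_sum, Finset.mul_sum]
    refine Finset.sum_congr rfl fun i _ => ?_
    push_cast
    rw [show (2 * Real.pi * Complex.I * (η i : ℂ)) = Complex.I * (2 * Real.pi * (η i : ℂ)) by ring,
      mul_pow, pow_mul Complex.I, Complex.I_sq]
  rw [hsum]
  simp only [HasCompactSupport.toSchwartzMap_toFun, smul_eq_mul, Complex.real_smul]
  change χ η = _
  have h1 : (-1 : ℂ) ^ k * (-1 : ℂ) ^ k = 1 := by
    rw [← mul_pow]
    simp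
  by_cases hη : η = 0
  · rw [hχ0 η (by simp [hη])]
    simp
  · have h2 : (D η : ℂ) ≠ 0 := by exact_mod_cast (hDpos η hη).ne'
    rw [show (-1 : ℂ) ^ k * (D η : ℂ) * ((-1) ^ k * (((D η)⁻¹ : ℝ) * χ η)) =
      ((-1 : ℂ) ^ k * (-1) ^ k) * ((D η : ℂ) * ((D η)⁻¹ : ℝ)) * χ η by ring, h1,
      Complex.ofReal_inv, mul_inv_cancel₀ h2]
    simp

/-- The difference between two consecutive regularisations `K * φ_s` and `K * φ_{2s}`, before the
convolution with `φ_{s/2}`. -/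
noncomputable def dyadicPart (k : ℕ) (K Ψ : 𝓢(Rn n, ℂ)) (s : ℝ) : 𝓢(Rn n, ℂ) :=
  ∑ i : Fin n, ((s ^ (2 * k) : ℝ) : ℂ) • sconv
    ((fun h : 𝓢(Rn n, ℂ) => ∂_{(EuclideanSpace.single i 1 : Rn n)} h)^[2 * k] K) (sdilate s Ψ)

lemma fourier_dyadicPart (k : ℕ) (K Ψ : 𝓢(Rn n, ℂ)) {s : ℝ} (hs : 0 < s) (ξ : Rn n) :
    𝓕 (dyadicPart k K Ψ s) ξ = 𝓕 K ξ *
      ((∑ i, (2 * Real.pi * Complex.I * ((s • ξ) i : ℝ)) ^ (2 * k)) * 𝓕 Ψ (s • ξ)) := by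
  have h : 𝓕 (dyadicPart k K Ψ s) = ∑ i : Fin n, ((s ^ (2 * k) : ℝ) : ℂ) • 𝓕 (sconv
      ((fun h : 𝓢(Rn n, ℂ) => ∂_{(EuclideanSpace.single i 1 : Rn n)} h)^[2 * k] K)
      (sdilate s Ψ)) := by
    rw [dyadicPart, ← FourierTransform.fourierCLM_apply (R := ℂ), map_sum]
    simp only [map_smul, FourierTransform.fourierCLM_apply]
  rw [h, _root_.sum_apply]
  simp only [_root_.smul_apply, fourier_sconv, fourier_iterate_lineDeriv,
    fourier_sdilate hs, smul_eq_mul, Finset.sum_mul, Finset.mul_sum]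
  refine Finset.sum_congr rfl fun i _ => ?_
  simp only [EuclideanSpace.inner_single_right, PiLp.smul_apply, smul_eq_mul, one_mul,
    conj_trivial, Complex.ofReal_mul, Complex.ofReal_pow]
  ring

/-- One step of the telescoping series, checked on the Fourier side. -/
lemma IsCutoff.sconv_sdilate_eq_add {φ : 𝓢(Rn n, ℂ)} (hφ : IsCutoff φ) {k : ℕ}
    {Ψ : 𝓢(Rn n, ℂ)} (hΨ : ∀ η : Rn n, 𝓕 φ η - 𝓕 φ ((2 : ℝ) • η) =
      (∑ i, (2 * Real.pi * Complex.I * (η i : ℝ)) ^ (2 * k)) * 𝓕 Ψ η)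
    (K : 𝓢(Rn n, ℂ)) {s : ℝ} (hs : 0 < s) :
    sconv K (sdilate s φ) = sconv K (sdilate (2 * s) φ) +
      sconv (sdilate (s / 2) φ) (dyadicPart k K Ψ s) := by
  refine schwartz_fourier_injective fun ξ => ?_
  rw [FourierTransform.fourier_add, _root_.add_apply, fourier_sconv, fourier_sconv,
    fourier_sconv, fourier_dyadicPart k K Ψ hs, ← hΨ, fourier_sdilate hs,
    fourier_sdilate (by positivity), fourier_sdilate (by positivity)]
  have h := hφ.half_mul_sub (s • ξ)
  rw [smul_smul, smul_smul] at h
  rw [smul_smul, show s / 2 = 1 / 2 * s by ring, mul_left_comm, h]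
  ring

/-- This treats the coarsest term, where there is no cancellation to exploit. -/
lemma IsCutoff.sconv_sdilate_eq {φ : 𝓢(Rn n, ℂ)} (hφ : IsCutoff φ)
    (K : 𝓢(Rn n, ℂ)) {s : ℝ} (hs : 0 < s) :
    sconv K (sdilate s φ) = sconv (sdilate (s / 2) φ) (sconv K (sdilate s φ)) := by
  refine schwartz_fourier_injective fun ξ => ?_
  rw [fourier_sconv, fourier_sconv, fourier_sconv, fourier_sdilate hs,
    fourier_sdilate (by positivity)]
  have h := hφ.half_mul (s • ξ)
  rw [smul_smul] at h
  rw [show s / 2 = 1 / 2 * s by ring, mul_left_comm, h]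

end Fourier

/-! ### The anisotropic dilation. -/

section Squeeze

variable {n : ℕ}

/-- The map `squeeze δ` as a linear map. -/
noncomputable def squeezeLM (δ : ℝ) : Rn n →ₗ[ℝ] Rn n where
  toFun := squeeze δ
  map_add' x y := by
    ext i
    simp only [squeeze, PiLp.add_apply]
    split_ifs <;> ring
  map_smul' c x := by
    ext i
    simp only [squeeze, PiLp.smul_apply, smul_eq_mul, RingHom.id_apply]
    split_ifs <;> ring

lemma squeeze_inv_squeeze {δ : ℝ} (hδ : δ ≠ 0) (x : Rn n) : squeeze δ⁻¹ (squeeze δ x) = x := by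
  ext i
  simp only [squeeze]
  split_ifs
  · field_simp
  · rfl

/-- The map `squeeze δ` as a continuous linear equivalence. -/
noncomputable def squeezeEquiv {δ : ℝ} (hδ : δ ≠ 0) : Rn n ≃L[ℝ] Rn n :=
  LinearEquiv.toContinuousLinearEquiv
    { squeezeLM δ with
      invFun := squeeze δ⁻¹
      left_inv := squeeze_inv_squeeze hδ
      right_inv := fun x => by
        have := squeeze_inv_squeeze (inv_ne_zero hδ) x
        rwa [inv_inv] at this }

lemma squeezeEquiv_apply {δ : ℝ} (hδ : δ ≠ 0) (x : Rn n) : squeezeEquiv hδ x = squeeze δ x := rfl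

lemma squeeze_single (δ : ℝ) (i : Fin n) :
    squeeze δ (EuclideanSpace.single i 1 : Rn n) =
      (if (i : ℕ) + 1 < n then δ⁻¹ else 1) • (EuclideanSpace.single i 1 : Rn n) := by
  ext j
  by_cases h : j = i
  · subst h
    simp only [squeeze, PiLp.single_apply, PiLp.smul_apply, smul_eq_mul]
    split_ifs <;> simp
  · rw [PiLp.smul_apply]
    simp [squeeze, h]

lemma det_squeezeLM {δ : ℝ} (hn : n ≠ 0) :
    LinearMap.det (squeezeLM δ : Rn n →ₗ[ℝ] Rn n) = (δ ^ (n - 1))⁻¹ := by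
  obtain ⟨m, rfl⟩ := Nat.exists_eq_succ_of_ne_zero hn
  rw [← LinearMap.det_toMatrix (EuclideanSpace.basisFun (Fin (m + 1)) ℝ).toBasis]
  have : LinearMap.toMatrix (EuclideanSpace.basisFun (Fin (m + 1)) ℝ).toBasis
      (EuclideanSpace.basisFun (Fin (m + 1)) ℝ).toBasis (squeezeLM δ) =
      Matrix.diagonal fun i : Fin (m + 1) => if (i : ℕ) + 1 < m + 1 then δ⁻¹ else 1 := by
    ext i j
    rw [LinearMap.toMatrix_apply]
    have h : squeezeLM δ ((EuclideanSpace.basisFun (Fin (m + 1)) ℝ).toBasis j) =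
        (if (j : ℕ) + 1 < m + 1 then δ⁻¹ else 1) • (EuclideanSpace.single j 1 : Rn (m + 1)) := by
      rw [← squeeze_single, OrthonormalBasis.coe_toBasis, EuclideanSpace.basisFun_apply]
      rfl
    rw [h]
    by_cases hij : i = j
    · subst hij
      rw [OrthonormalBasis.coe_toBasis_repr_apply, EuclideanSpace.basisFun_repr, PiLp.smul_apply]
      simp
    · rw [OrthonormalBasis.coe_toBasis_repr_apply, EuclideanSpace.basisFun_repr, PiLp.smul_apply]
      simp [hij]
  rw [this, Matrix.det_diagonal, Fin.prod_univ_castSucc]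
  simp

lemma norm_le_norm_squeeze {δ : ℝ} (hδ : 0 < δ) (hδ1 : δ ≤ 1) (x : Rn n) :
    ‖x‖ ≤ ‖squeeze δ x‖ := by
  rw [EuclideanSpace.norm_eq, EuclideanSpace.norm_eq]
  refine Real.sqrt_le_sqrt (Finset.sum_le_sum fun i _ => ?_)
  simp only [squeeze]
  split_ifs
  · rw [norm_div, Real.norm_of_nonneg hδ.le]
    refine pow_le_pow_left₀ (norm_nonneg _) (le_div_self (norm_nonneg _) hδ hδ1) _
  · exact le_rfl

lemma lintegral_comp_squeeze {δ : ℝ} (hδ : 0 < δ) (hn : n ≠ 0) {h : Rn n → ℝ≥0∞}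
    (hh : Measurable h) :
    ∫⁻ x, h (squeeze δ x) = ENNReal.ofReal (δ ^ (n - 1)) * ∫⁻ x, h x := by
  have hdet := det_squeezeLM (δ := δ) hn
  have hm := Measure.map_linearMap_addHaar_eq_smul_addHaar (volume : Measure (Rn n))
    (f := squeezeLM δ) (by rw [hdet]; positivity)
  rw [hdet, inv_inv, abs_of_pos (by positivity)] at hm
  have hmeas : Measurable (squeezeLM δ : Rn n → Rn n) :=
    (squeezeEquiv hδ.ne').continuous.measurable
  have := lintegral_map (μ := volume) hh hmeas
  rw [hm, lintegral_smul_measure] at this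
  exact this.symm

/-- The anisotropic dilation `g_I` as a Schwartz function. -/
noncomputable def saniso {δ : ℝ} (hδ : δ ≠ 0) (g : 𝓢(Rn n, ℂ)) : 𝓢(Rn n, ℂ) :=
  (((δ ^ (n - 1))⁻¹ : ℝ) : ℂ) •
    SchwartzMap.compCLMOfContinuousLinearEquiv ℂ (squeezeEquiv hδ) g

lemma coe_saniso {δ : ℝ} (hδ : δ ≠ 0) (g : 𝓢(Rn n, ℂ)) :
    (saniso hδ g : Rn n → ℂ) = anisoDilate δ g := rfl

/-- Each derivative costs `δ⁻¹` in the thin directions and nothing along the axis of the tube. -/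
lemma iterate_lineDeriv_saniso {δ : ℝ} (hδ : δ ≠ 0) (g : 𝓢(Rn n, ℂ)) (i : Fin n) (m : ℕ) :
    (fun h : 𝓢(Rn n, ℂ) => ∂_{(EuclideanSpace.single i 1 : Rn n)} h)^[m] (saniso hδ g) =
      (((if (i : ℕ) + 1 < n then δ⁻¹ else 1) ^ m : ℝ) : ℂ) • saniso hδ
        ((fun h : 𝓢(Rn n, ℂ) => ∂_{(EuclideanSpace.single i 1 : Rn n)} h)^[m] g) := by
  induction m with
  | zero => simp
  | succ m ih =>
    rw [Function.iterate_succ_apply', ih, Function.iterate_succ_apply']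
    simp only [saniso]
    rw [LineDeriv.lineDerivOp_smul, LineDeriv.lineDerivOp_smul,
      SchwartzMap.lineDerivOp_compCLMOfContinuousLinearEquiv, squeezeEquiv_apply, squeeze_single,
      LineDeriv.lineDerivOp_left_smul]
    ext x
    simp only [_root_.smul_apply, SchwartzMap.compCLMOfContinuousLinearEquiv_apply,
      Function.comp_apply, smul_eq_mul, Complex.real_smul, Complex.ofReal_mul, pow_succ]
    ring

end Squeeze

/-! ### Decay of functions in the class `S_{α,β}`. -/

section SchwartzClass

variable {n : ℕ}

lemma foldr_iterate_single {X : Type*} (F : Fin n → X → X) (i : Fin n) (m : ℕ) (x : X)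
    (l : List (Fin n)) (hl : l.Nodup) :
    l.foldr (fun j g => (F j)^[(Pi.single i m : Fin n → ℕ) j] g) x =
      if i ∈ l then (F i)^[m] x else x := by
  induction l with
  | nil => simp
  | cons j l ih =>
    rw [List.foldr_cons, ih hl.of_cons]
    by_cases h : i = j
    · subst h
      have : i ∉ l := (List.nodup_cons.1 hl).1
      simp [this]
    · simp [h, Ne.symm h]

lemma mixedDeriv_single (i : Fin n) (m : ℕ) (g : 𝓢(Rn n, ℂ)) :
    mixedDeriv (Pi.single i m) g =
      (fun h : 𝓢(Rn n, ℂ) => ∂_{(EuclideanSpace.single i 1 : Rn n)} h)^[m] g := by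
  rw [mixedDeriv, foldr_iterate_single (fun (i : Fin n) (h : 𝓢(Rn n, ℂ)) =>
    ∂_{(EuclideanSpace.single i 1 : Rn n)} h) i m g _ (List.nodup_finRange n)]
  simp

lemma multiLen_single (i : Fin n) (m : ℕ) : multiLen (Pi.single i m) = m := by
  simp [multiLen]

lemma monomialAt_single (i : Fin n) (m : ℕ) (x : Rn n) :
    monomialAt (Pi.single i m) x = x i ^ m := by
  rw [monomialAt, Finset.prod_eq_single i]
  · simp
  · intro j _ hj
    simp [hj]
  · simp

/-- Decay of the pure derivatives of the functions in `S_{α,β}`. -/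
lemma norm_iterate_lineDeriv_le_of_mem_schwartzClass {α β : Fin n → ℕ} {g : 𝓢(Rn n, ℂ)}
    (hg : g ∈ schwartzClass α β) {k m : ℕ} (hk : k ≤ multiLen α) (hm : m ≤ multiLen β)
    (i : Fin n) (x : Rn n) :
    ‖((fun h : 𝓢(Rn n, ℂ) => ∂_{(EuclideanSpace.single i 1 : Rn n)} h)^[m] g) x‖ ≤
      (2 * n) ^ k * ((1 + ‖x‖) ^ k)⁻¹ := by
  rw [← mixedDeriv_single, ← div_eq_mul_inv, le_div_iff₀ (by positivity)]
  have hn : (1 : ℝ) ≤ n := by exact_mod_cast (i.pos)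
  have hm' : multiLen (Pi.single i m) ≤ multiLen β := by rwa [multiLen_single]
  -- Powers of the largest coordinate suffice: `1 + ‖x‖ ≤ 2 * n * |x j|` once `1 ≤ ‖x‖`, and the
  -- trivial monomial handles `‖x‖ ≤ 1`.
  obtain ⟨j, -, hj⟩ := Finset.exists_max_image Finset.univ (fun j => |x j|) ⟨i, Finset.mem_univ _⟩
  have hx : ‖x‖ ≤ n * |x j| := by
    rw [EuclideanSpace.norm_eq]
    refine Real.sqrt_le_iff.2 ⟨by positivity, ?_⟩
    calc ∑ i, ‖x i‖ ^ 2 ≤ ∑ _i : Fin n, |x j| ^ 2 :=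
          Finset.sum_le_sum fun l hl => pow_le_pow_left₀ (norm_nonneg _) (hj l hl) _
      _ = n * |x j| ^ 2 := by simp
      _ ≤ (n * |x j|) ^ 2 := by
          rw [mul_pow]
          exact mul_le_mul_of_nonneg_right (by nlinarith) (by positivity)
  rcases le_total ‖x‖ 1 with h | h
  · have h0 := hg 0 (Pi.single i m) (by simp [multiLen]) hm' x
    simp only [monomialAt, Pi.zero_apply, pow_zero, Finset.prod_const_one, Complex.ofReal_one,
      one_mul] at h0
    calc _ ≤ 1 * (2 * n : ℝ) ^ k := by
          gcongr
          linarith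
      _ = _ := one_mul _
  · have h1 := hg (Pi.single j k) (Pi.single i m) (by rwa [multiLen_single]) hm' x
    rw [monomialAt_single, norm_mul, Complex.norm_real, norm_pow, Real.norm_eq_abs] at h1
    calc ‖mixedDeriv (Pi.single i m) g x‖ * (1 + ‖x‖) ^ k
        ≤ ‖mixedDeriv (Pi.single i m) g x‖ * (2 * n * |x j|) ^ k := by
          gcongr
          linarith
      _ = (2 * n) ^ k * (|x j| ^ k * ‖mixedDeriv (Pi.single i m) g x‖) := by
          rw [mul_pow]
          ring
      _ ≤ (2 * n) ^ k * 1 := by gcongr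
      _ = _ := mul_one _

end SchwartzClass

/-! ### Weighted `L¹` norms of kernels. -/

section WeightedNorm

variable {n : ℕ}

/-- The `L¹` norm with weight `(1 + ‖u‖) ^ n`. -/
noncomputable def weightedNorm (g : Rn n → ℂ) : ℝ≥0∞ :=
  ∫⁻ u, ‖g u‖ₑ * ENNReal.ofReal ((1 + ‖u‖) ^ n)

lemma lintegral_inv_one_add_norm_pow_ne_top :
    ∫⁻ u : Rn n, ENNReal.ofReal (((1 + ‖u‖) ^ (n + 1))⁻¹) ≠ ∞ :=
  (integrable_inv_one_add_norm_pow (n := n)).lintegral_lt_top.ne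

/-- The weight consumes `n` powers of decay and integrability another `n + 1`. Hence the threshold
`2 * n + 1` on `|α|`. -/
lemma weightedNorm_le_of_decay {B : ℝ} {g : Rn n → ℂ}
    (hg : ∀ x, ‖g x‖ ≤ B * ((1 + ‖x‖) ^ (2 * n + 1))⁻¹) :
    weightedNorm g ≤
      ENNReal.ofReal B * ∫⁻ u : Rn n, ENNReal.ofReal (((1 + ‖u‖) ^ (n + 1))⁻¹) := by
  rw [← lintegral_const_mul _ (by fun_prop)]
  refine lintegral_mono fun u => ?_
  have hB : 0 ≤ B := by
    have := (norm_nonneg _).trans (hg 0)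
    simpa using this
  rw [← ofReal_norm, ← ENNReal.ofReal_mul (norm_nonneg _), ← ENNReal.ofReal_mul hB]
  refine ENNReal.ofReal_le_ofReal ?_
  calc ‖g u‖ * (1 + ‖u‖) ^ n ≤ B * ((1 + ‖u‖) ^ (2 * n + 1))⁻¹ * (1 + ‖u‖) ^ n := by
        gcongr
        exact hg u
    _ = B * ((1 + ‖u‖) ^ (n + 1))⁻¹ := by
        rw [show 2 * n + 1 = n + 1 + n by ring, pow_add _ (n + 1)]
        field_simp

lemma weightedNorm_schwartz_ne_top (g : 𝓢(Rn n, ℂ)) : weightedNorm (g : Rn n → ℂ) ≠ ∞ := by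
  obtain ⟨B, hB, hg⟩ := exists_norm_le_inv_one_add_norm_pow g (2 * n + 1)
  exact ne_top_of_le_ne_top
    (ENNReal.mul_ne_top ENNReal.ofReal_ne_top lintegral_inv_one_add_norm_pow_ne_top)
    (weightedNorm_le_of_decay hg)

lemma weightedNorm_const_smul (c : ℂ) (g : 𝓢(Rn n, ℂ)) :
    weightedNorm (c • g : 𝓢(Rn n, ℂ)) = ‖c‖ₑ * weightedNorm (g : Rn n → ℂ) := by
  have := g.continuous
  rw [weightedNorm, weightedNorm, ← lintegral_const_mul _ (by fun_prop)]
  simp only [_root_.smul_apply, enorm_smul, mul_assoc]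

lemma weightedNorm_sum_le {ι : Type*} (s : Finset ι) (g : ι → 𝓢(Rn n, ℂ)) :
    weightedNorm (∑ i ∈ s, g i : 𝓢(Rn n, ℂ)) ≤ ∑ i ∈ s, weightedNorm (g i : Rn n → ℂ) := by
  simp only [weightedNorm]
  rw [← lintegral_finsetSum]
  · refine lintegral_mono fun u => ?_
    simp only
    rw [_root_.sum_apply, ← Finset.sum_mul]
    gcongr
    exact enorm_sum_le _ _
  · intro i _
    have := (g i).continuous
    fun_prop

/-- The weight is submultiplicative: `1 + ‖u‖ ≤ (1 + ‖u - y‖) * (1 + ‖y‖)`. -/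
lemma weightedNorm_sconv_le (a b : 𝓢(Rn n, ℂ)) :
    weightedNorm (sconv a b : Rn n → ℂ) ≤
      weightedNorm (a : Rn n → ℂ) * weightedNorm (b : Rn n → ℂ) := by
  have hac := a.continuous
  have hbc := b.continuous
  have ham := hac.measurable
  have hw (u y : Rn n) : ENNReal.ofReal ((1 + ‖u‖) ^ n) ≤
      ENNReal.ofReal ((1 + ‖u - y‖) ^ n) * ENNReal.ofReal ((1 + ‖y‖) ^ n) := by
    rw [← ENNReal.ofReal_mul (by positivity), ← mul_pow]
    refine ENNReal.ofReal_le_ofReal (pow_le_pow_left₀ (by positivity) ?_ _)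
    have := one_add_norm_le_mul y u
    rw [norm_sub_rev y u] at this
    linarith
  calc weightedNorm (sconv a b : Rn n → ℂ)
      ≤ ∫⁻ u, ∫⁻ y, (‖a (u - y)‖ₑ * ENNReal.ofReal ((1 + ‖u - y‖) ^ n)) *
          (‖b y‖ₑ * ENNReal.ofReal ((1 + ‖y‖) ^ n)) := by
        refine lintegral_mono fun u => ?_
        simp only
        rw [sconv_apply, conv]
        refine (mul_le_mul_left (enorm_integral_le_lintegral_enorm _) _).trans ?_
        rw [← lintegral_mul_const _ (by fun_prop)]
        refine lintegral_mono fun y => ?_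
        simp only [enorm_mul]
        refine (mul_le_mul_right (hw u y) _).trans (le_of_eq (by ring))
    _ = ∫⁻ y, ∫⁻ u, (‖a (u - y)‖ₑ * ENNReal.ofReal ((1 + ‖u - y‖) ^ n)) *
          (‖b y‖ₑ * ENNReal.ofReal ((1 + ‖y‖) ^ n)) :=
        lintegral_lintegral_swap (by fun_prop)
    _ = ∫⁻ y, weightedNorm (a : Rn n → ℂ) * (‖b y‖ₑ * ENNReal.ofReal ((1 + ‖y‖) ^ n)) := by
        refine lintegral_congr fun y => ?_
        rw [lintegral_mul_const _ (by fun_prop), lintegral_sub_right_eq_self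
          (fun u => ‖a u‖ₑ * ENNReal.ofReal ((1 + ‖u‖) ^ n)), weightedNorm]
    _ = _ := lintegral_const_mul _ (by fun_prop)

lemma lintegral_comp_inv_smul {s : ℝ} (hs : 0 < s) {h : Rn n → ℝ≥0∞} (hh : Measurable h) :
    ∫⁻ x, h (s⁻¹ • x) = ENNReal.ofReal (s ^ n) * ∫⁻ x, h x := by
  have hm := Measure.map_addHaar_smul (volume : Measure (Rn n)) (inv_ne_zero hs.ne')
  have := lintegral_map (μ := volume) hh (measurable_const_smul s⁻¹)
  rw [hm, lintegral_smul_measure] at this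
  rw [← this]
  simp [abs_of_pos hs]

lemma weightedNorm_sdilate_le {s : ℝ} (hs : 0 < s) (hs1 : s ≤ 1) (g : 𝓢(Rn n, ℂ)) :
    weightedNorm (sdilate s g : Rn n → ℂ) ≤ weightedNorm (g : Rn n → ℂ) := by
  have hgc := g.continuous.measurable
  calc weightedNorm (sdilate s g : Rn n → ℂ)
      ≤ ∫⁻ u, ENNReal.ofReal ((s ^ n)⁻¹) *
          (‖g (s⁻¹ • u)‖ₑ * ENNReal.ofReal ((1 + ‖s⁻¹ • u‖) ^ n)) := by
        refine lintegral_mono fun u => ?_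
        simp only [coe_sdilate hs.ne', dilate]
        rw [enorm_mul, ← ofReal_norm (((s ^ n)⁻¹ : ℝ) : ℂ), Complex.norm_real,
          Real.norm_of_nonneg (by positivity), mul_assoc]
        gcongr
        rw [norm_smul, Real.norm_of_nonneg (by positivity)]
        exact le_mul_of_one_le_left (norm_nonneg _) ((one_le_inv₀ hs).2 hs1)
    _ = weightedNorm (g : Rn n → ℂ) := by
        rw [lintegral_const_mul _ (by fun_prop), lintegral_comp_inv_smul hs
          (h := fun u => ‖g u‖ₑ * ENNReal.ofReal ((1 + ‖u‖) ^ n)) (by fun_prop), ← mul_assoc,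
          ← ENNReal.ofReal_mul (by positivity), inv_mul_cancel₀ (by positivity),
          ENNReal.ofReal_one, one_mul, weightedNorm]

/-- The anisotropic dilation preserves the `L¹` norm and, as `δ ≤ 1`, moves mass towards the origin,
where the weight is smaller. -/
lemma weightedNorm_saniso_le {δ : ℝ} (hδ : 0 < δ) (hδ1 : δ ≤ 1) (hn : n ≠ 0) (g : 𝓢(Rn n, ℂ)) :
    weightedNorm (saniso hδ.ne' g : Rn n → ℂ) ≤ weightedNorm (g : Rn n → ℂ) := by
  have hgc := g.continuous.measurable
  have hsq : Continuous (squeeze δ : Rn n → Rn n) := (squeezeEquiv hδ.ne').continuous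
  have hsqm := hsq.measurable
  calc weightedNorm (saniso hδ.ne' g : Rn n → ℂ)
      ≤ ∫⁻ u, ENNReal.ofReal ((δ ^ (n - 1))⁻¹) *
          (‖g (squeeze δ u)‖ₑ * ENNReal.ofReal ((1 + ‖squeeze δ u‖) ^ n)) := by
        refine lintegral_mono fun u => ?_
        simp only [coe_saniso, anisoDilate]
        rw [enorm_mul, ← ofReal_norm (((δ ^ (n - 1))⁻¹ : ℝ) : ℂ), Complex.norm_real,
          Real.norm_of_nonneg (by positivity), mul_assoc]
        gcongr
        exact norm_le_norm_squeeze hδ hδ1 u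
    _ = weightedNorm (g : Rn n → ℂ) := by
        rw [lintegral_const_mul _ (by fun_prop), lintegral_comp_squeeze hδ hn
          (h := fun u => ‖g u‖ₑ * ENNReal.ofReal ((1 + ‖u‖) ^ n)) (by fun_prop), ← mul_assoc,
          ← ENNReal.ofReal_mul (by positivity), inv_mul_cancel₀ (by positivity),
          ENNReal.ofReal_one, one_mul, weightedNorm]

/-- The gain from the cancellation of `φ_s - φ_{2s}` in the convolution with a thin tube. -/
lemma weightedNorm_dyadicPart_saniso_le {δ : ℝ} (hδ : 0 < δ) (hδ1 : δ ≤ 1) (hn : n ≠ 0) {k : ℕ}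
    {s : ℝ} (hs : 0 < s) (hs1 : s ≤ 1) (g Ψ : 𝓢(Rn n, ℂ)) {D : ℝ≥0∞}
    (hD : ∀ i : Fin n, weightedNorm ((fun h : 𝓢(Rn n, ℂ) =>
      ∂_{(EuclideanSpace.single i 1 : Rn n)} h)^[2 * k] g : 𝓢(Rn n, ℂ)) ≤ D) :
    weightedNorm (dyadicPart k (saniso hδ.ne' g) Ψ s : Rn n → ℂ) ≤
      ENNReal.ofReal ((s / δ) ^ (2 * k)) * (n * D * weightedNorm (Ψ : Rn n → ℂ)) := by
  rw [dyadicPart]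
  refine (weightedNorm_sum_le _ _).trans ?_
  have hterm (i : Fin n) : weightedNorm (((s ^ (2 * k) : ℝ) : ℂ) • sconv
      ((fun h : 𝓢(Rn n, ℂ) => ∂_{(EuclideanSpace.single i 1 : Rn n)} h)^[2 * k]
        (saniso hδ.ne' g)) (sdilate s Ψ) : 𝓢(Rn n, ℂ)) ≤
      ENNReal.ofReal ((s / δ) ^ (2 * k)) * (D * weightedNorm (Ψ : Rn n → ℂ)) := by
    rw [weightedNorm_const_smul, iterate_lineDeriv_saniso]
    have hc : (if (i : ℕ) + 1 < n then δ⁻¹ else 1) ^ (2 * k) ≤ (δ⁻¹) ^ (2 * k) := by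
      have : 1 ≤ δ⁻¹ := (one_le_inv₀ hδ).2 hδ1
      split_ifs
      · exact le_rfl
      · exact pow_le_pow_left₀ zero_le_one this _
    have hc0 : 0 ≤ (if (i : ℕ) + 1 < n then δ⁻¹ else 1) ^ (2 * k) := (even_two_mul k).pow_nonneg _
    have h1 := weightedNorm_sconv_le (((((if (i : ℕ) + 1 < n then δ⁻¹ else 1) ^ (2 * k) : ℝ) : ℂ) •
      saniso hδ.ne' ((fun h : 𝓢(Rn n, ℂ) =>
        ∂_{(EuclideanSpace.single i 1 : Rn n)} h)^[2 * k] g))) (sdilate s Ψ)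
    rw [weightedNorm_const_smul] at h1
    rw [div_eq_mul_inv, mul_pow, ENNReal.ofReal_mul (by positivity)]
    rw [← ofReal_norm, Complex.norm_real, Real.norm_of_nonneg hc0] at h1
    rw [← ofReal_norm, Complex.norm_real, Real.norm_of_nonneg (by positivity), mul_assoc]
    refine mul_le_mul_right (h1.trans ?_) _
    rw [← mul_assoc]
    gcongr
    · exact (weightedNorm_saniso_le hδ hδ1 hn _).trans (hD i)
    · exact weightedNorm_sdilate_le hs hs1 Ψ
  refine (Finset.sum_le_sum fun i _ => hterm i).trans (le_of_eq ?_)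
  simp only [Finset.sum_const, Finset.card_univ, Fintype.card_fin, nsmul_eq_mul]
  ring

end WeightedNorm

/-! ### The estimate for a single tube. -/

section Tube

variable {n : ℕ}

/-- Associativity puts `f * φ_{δτ}` against `e`, and `(1 + ‖u‖/τ)^n ≤ τ^{-n} (1 + ‖u‖)^n` for `τ ≤
1`. This growth dictates the weight in `weightedNorm`. -/
lemma enorm_conv_sconv_sdilate_le {f : Rn n → ℂ} (hf : WeightedIntegrable f) {φ : 𝓢(Rn n, ℂ)}
    {δ : ℝ} (hδ : 0 < δ) {X : ℝ≥0∞}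
    (hX : ∀ τ : ℝ, 0 < τ → ∀ u : Rn n,
      ‖conv f (dilate (δ * τ) φ) u‖ₑ ≤ ENNReal.ofReal ((1 + ‖u‖ / τ) ^ n) * X)
    {τ : ℝ} (hτ : 0 < τ) (hτ1 : τ ≤ 1) (e : 𝓢(Rn n, ℂ)) :
    ‖conv f (sconv (sdilate (δ * τ) φ) e) 0‖ₑ ≤
      ENNReal.ofReal (τ⁻¹ ^ n) * (weightedNorm (e : Rn n → ℂ) * X) := by
  have hec := e.continuous
  rw [← hf.conv_conv, conv, coe_sdilate (by positivity)]
  refine (enorm_integral_le_lintegral_enorm _).trans ?_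
  rw [weightedNorm, ← mul_assoc, mul_comm _ X, ← lintegral_const_mul _ (by fun_prop),
    ← lintegral_const_mul _ (by fun_prop)]
  refine lintegral_mono fun u => ?_
  simp only
  rw [enorm_mul]
  refine (mul_le_mul_left (hX τ hτ (0 - u)) _).trans ?_
  rw [zero_sub, norm_neg]
  have h1 : ENNReal.ofReal ((1 + ‖u‖ / τ) ^ n) ≤
      ENNReal.ofReal (τ⁻¹ ^ n) * ENNReal.ofReal ((1 + ‖u‖) ^ n) := by
    rw [← ENNReal.ofReal_mul (by positivity), ← mul_pow]
    refine ENNReal.ofReal_le_ofReal (pow_le_pow_left₀ (by positivity) ?_ _)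
    have := (one_le_inv₀ hτ).2 hτ1
    rw [div_eq_inv_mul, mul_add, mul_one]
    linarith
  calc ENNReal.ofReal ((1 + ‖u‖ / τ) ^ n) * X * ‖e u‖ₑ
      ≤ (ENNReal.ofReal (τ⁻¹ ^ n) * ENNReal.ofReal ((1 + ‖u‖) ^ n)) * X * ‖e u‖ₑ := by gcongr
    _ = _ := by ring

/-- Averages of `f` over thin tubes are controlled by the values of `f * φ_{δτ}`, if these grow
at most like `(1 + ‖u‖ / τ) ^ n`. -/
theorem IsCutoff.exists_enorm_conv_anisoDilate_le {φ : 𝓢(Rn n, ℂ)} (hφ : IsCutoff φ)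
    (hn : n ≠ 0) : ∃ C : ℝ, 0 < C ∧ ∀ α β : Fin n → ℕ, 2 * n + 1 ≤ multiLen α →
      2 * n + 1 ≤ multiLen β → ∀ g ∈ schwartzClass α β, ∀ δ : ℝ, 0 < δ → δ < 1 →
      ∀ f : Rn n → ℂ, WeightedIntegrable f → ∀ X : ℝ≥0∞,
      (∀ τ : ℝ, 0 < τ → ∀ u : Rn n,
        ‖conv f (dilate (δ * τ) φ) u‖ₑ ≤ ENNReal.ofReal ((1 + ‖u‖ / τ) ^ n) * X) →
      ‖conv f (anisoDilate δ g) 0‖ₑ ≤ ENNReal.ofReal C * X := by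
  -- Order `2 * n` gains `2^{-2n}` per scale, which beats the loss `2^n` from the growth hypothesis.
  obtain ⟨Ψ, hΨ⟩ := hφ.exists_fourier_sub_eq n
  set D : ℝ≥0∞ := ENNReal.ofReal ((2 * n) ^ (2 * n + 1)) *
    ∫⁻ u : Rn n, ENNReal.ofReal (((1 + ‖u‖) ^ (n + 1))⁻¹) with hD
  have hDtop : D ≠ ∞ :=
    ENNReal.mul_ne_top ENNReal.ofReal_ne_top lintegral_inv_one_add_norm_pow_ne_top
  -- The coarsest term uses `τ = 1/2`, whence `2 ^ n`; `c1` belongs to the differences, and its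
  -- factor 2 below is the geometric sum.
  set c0 : ℝ≥0∞ := ENNReal.ofReal (2 ^ n) * (D * weightedNorm (φ : Rn n → ℂ)) with hc0
  set c1 : ℝ≥0∞ := n * D * weightedNorm (Ψ : Rn n → ℂ) with hc1
  have hc0top : c0 ≠ ∞ := ENNReal.mul_ne_top ENNReal.ofReal_ne_top
    (ENNReal.mul_ne_top hDtop (weightedNorm_schwartz_ne_top φ))
  have hc1top : c1 ≠ ∞ := ENNReal.mul_ne_top (ENNReal.mul_ne_top (ENNReal.natCast_ne_top n) hDtop)
    (weightedNorm_schwartz_ne_top Ψ)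
  have hctop : c0 + c1 * 2 ≠ ∞ :=
    ENNReal.add_ne_top.2 ⟨hc0top, ENNReal.mul_ne_top hc1top ENNReal.ofNat_ne_top⟩
  refine ⟨(c0 + c1 * 2).toReal + 1, by positivity, ?_⟩
  intro α β hα hβ g hg δ hδ hδ1 f hf X hX
  have hC : c0 + c1 * 2 ≤ ENNReal.ofReal ((c0 + c1 * 2).toReal + 1) :=
    (ENNReal.le_ofReal_iff_toReal_le hctop (by positivity)).2 (by linarith)
  have hderiv (i : Fin n) (m : ℕ) (hm : m ≤ 2 * n + 1) : weightedNorm ((fun h : 𝓢(Rn n, ℂ) =>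
      ∂_{(EuclideanSpace.single i 1 : Rn n)} h)^[m] g : 𝓢(Rn n, ℂ)) ≤ D :=
    weightedNorm_le_of_decay fun x =>
      norm_iterate_lineDeriv_le_of_mem_schwartzClass hg hα (hm.trans hβ) i x
  set K := saniso hδ.ne' g with hK
  set s : ℕ → ℝ := fun k => δ * (1 / 2) ^ k with hs
  have hspos (k : ℕ) : 0 < s k := by positivity
  have hpow1 (k : ℕ) : (1 / 2 : ℝ) ^ k ≤ 1 := pow_le_one₀ (by norm_num) (by norm_num)
  have hs1 (k : ℕ) : s k ≤ 1 := by
    have := hpow1 k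
    simp only [hs]
    nlinarith [hspos k]
  have hslim : Filter.Tendsto s Filter.atTop (nhds 0) := by
    have := (tendsto_pow_atTop_nhds_zero_of_lt_one (r := (1 / 2 : ℝ)) (by norm_num)
      (by norm_num)).const_mul δ
    rwa [mul_zero] at this
  have hhalf (k : ℕ) : s k / 2 = δ * (1 / 2) ^ (k + 1) := by
    simp only [hs, pow_succ]
    ring
  have hbound (k : ℕ) : ‖conv f (sconv K (sdilate (s k) φ)) 0‖ₑ ≤
      c0 * X + c1 * X * ∑ j ∈ Finset.range k, (2⁻¹ : ℝ≥0∞) ^ j := by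
    induction k with
    | zero =>
      rw [hφ.sconv_sdilate_eq K (hspos 0), hhalf]
      refine (enorm_conv_sconv_sdilate_le hf hδ hX (by positivity) (hpow1 _) _).trans ?_
      simp only [Finset.range_zero, Finset.sum_empty, mul_zero, add_zero, zero_add, pow_one,
        one_div, inv_inv, hc0, mul_assoc]
      refine mul_le_mul_right ?_ _
      rw [← mul_assoc]
      refine mul_le_mul_left ?_ _
      refine (weightedNorm_sconv_le _ _).trans (mul_le_mul' ?_
        (weightedNorm_sdilate_le (hspos 0) (hs1 0) φ))
      exact (weightedNorm_saniso_le hδ hδ1.le hn g).trans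
        (hderiv ⟨0, Nat.pos_of_ne_zero hn⟩ 0 (Nat.zero_le _))
    | succ k ih =>
      have h2 : 2 * s (k + 1) = s k := by
        simp only [hs, pow_succ]
        ring
      rw [hφ.sconv_sdilate_eq_add hΨ K (hspos (k + 1)), h2]
      have hadd := hf.conv_add (sconv K (sdilate (s k) φ))
        (sconv (sdilate (s (k + 1) / 2) φ) (dyadicPart n K Ψ (s (k + 1)))) 0
      have hcoe : ∀ a b : 𝓢(Rn n, ℂ), ((a + b : 𝓢(Rn n, ℂ)) : Rn n → ℂ) = a + b := fun _ _ => rfl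
      rw [hcoe, hadd, Finset.sum_range_succ, mul_add, ← add_assoc]
      refine (enorm_add_le _ _).trans (add_le_add ih ?_)
      rw [hhalf]
      refine (enorm_conv_sconv_sdilate_le hf hδ hX (by positivity) (hpow1 _) _).trans ?_
      have hW := weightedNorm_dyadicPart_saniso_le hδ hδ1.le hn (k := n) (hspos (k + 1))
        (hs1 (k + 1)) g Ψ (fun i => hderiv i (2 * n) (by omega))
      rw [← hc1] at hW
      calc ENNReal.ofReal ((((1 / 2 : ℝ) ^ (k + 1 + 1))⁻¹) ^ n) *
            (weightedNorm (dyadicPart n K Ψ (s (k + 1)) : Rn n → ℂ) * X)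
          ≤ ENNReal.ofReal ((((1 / 2 : ℝ) ^ (k + 1 + 1))⁻¹) ^ n) *
            (ENNReal.ofReal ((s (k + 1) / δ) ^ (2 * n)) * c1 * X) := by gcongr
        _ = c1 * X * ENNReal.ofReal ((((1 / 2 : ℝ) ^ (k + 1 + 1))⁻¹) ^ n *
              (s (k + 1) / δ) ^ (2 * n)) := by
            rw [ENNReal.ofReal_mul (by positivity)]
            ring
        -- Here `τ = 2^{-(k+2)}` and `s / δ = 2^{-(k+1)}`, so the product is `2^{n(k+2) - 2n(k+1)} =
        -- 2^{-nk} ≤ 2^{-k}`.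
        _ ≤ c1 * X * (2⁻¹ : ℝ≥0∞) ^ k := by
            refine mul_le_mul_right ?_ _
            have h3 : (((1 / 2 : ℝ) ^ (k + 1 + 1))⁻¹) ^ n * (s (k + 1) / δ) ^ (2 * n) =
                ((1 / 2 : ℝ) ^ k) ^ n := by
              have : s (k + 1) / δ = (1 / 2) ^ (k + 1) := by
                simp only [hs]
                field_simp
              rw [this, pow_mul, ← mul_pow]
              congr 1
              rw [pow_succ, pow_succ]
              have : (1 / 2 : ℝ) ^ k ≠ 0 := by positivity
              field_simp
            have h4 : ((1 / 2 : ℝ) ^ k) ^ n ≤ (1 / 2 : ℝ) ^ k :=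
              pow_le_of_le_one (by positivity) (hpow1 k) hn
            rw [h3]
            refine (ENNReal.ofReal_le_ofReal h4).trans (le_of_eq ?_)
            rw [ENNReal.ofReal_pow (by norm_num), one_div, ENNReal.ofReal_inv_of_pos two_pos,
              ENNReal.ofReal_ofNat]
  have hbound' (k : ℕ) : ‖conv (conv f K) (dilate (s k) φ) 0‖ₑ ≤
      ENNReal.ofReal ((c0 + c1 * 2).toReal + 1) * X := by
    rw [← coe_sdilate (hspos k).ne', hf.conv_conv]
    refine (hbound k).trans (le_trans ?_ (mul_le_mul_left hC X))
    have hgeom : ∑ j ∈ Finset.range k, (2⁻¹ : ℝ≥0∞) ^ j ≤ 2 := by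
      refine (ENNReal.sum_le_tsum _).trans (le_of_eq ?_)
      rw [ENNReal.tsum_geometric, ENNReal.one_sub_inv_two, inv_inv]
    calc c0 * X + c1 * X * ∑ j ∈ Finset.range k, (2⁻¹ : ℝ≥0∞) ^ j
        ≤ c0 * X + c1 * X * 2 := by gcongr
      _ = (c0 + c1 * 2) * X := by ring
  have hlim := hf.tendsto_conv_conv_dilate K φ hφ.integral_eq_one hspos hs1 hslim
  exact le_of_tendsto hlim.enorm (Filter.Eventually.of_forall hbound')

end Tube

/-! ### Pointwise control by maximal functions. -/

section Nontangential

open Metric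

variable {n : ℕ}

lemma le_nontangentialMaximal (ψ f : Rn n → ℂ) {x y : Rn n} {t : ℝ} (ht : 0 < t)
    (hxy : ‖x - y‖ ≤ t) : ‖conv f (dilate t ψ) y‖ₑ ≤ nontangentialMaximal ψ f x :=
  le_iSup_of_le t (le_iSup_of_le ht (le_iSup_of_le y (le_iSup_of_le hxy le_rfl)))

/-- Substituting `y = x + z` removes `x` from the constraint, leaving a supremum of continuous
functions of `x`. -/
lemma measurable_nontangentialMaximal {f : Rn n → ℂ} (hf : WeightedIntegrable f)
    (ψ : 𝓢(Rn n, ℂ)) : Measurable (nontangentialMaximal ψ f) := by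
  have h : nontangentialMaximal ψ f = fun x => ⨆ (t : ℝ) (_ : 0 < t) (z : Rn n) (_ : ‖z‖ ≤ t),
      ‖conv f (dilate t ψ) (x + z)‖ₑ := by
    ext x
    refine iSup_congr fun t => iSup_congr fun ht => le_antisymm ?_ ?_
    · refine iSup_le fun y => iSup_le fun hy => ?_
      refine le_iSup_of_le (y - x) (le_iSup_of_le (by rwa [norm_sub_rev]) ?_)
      rw [add_sub_cancel]
    · refine iSup_le fun z => iSup_le fun hz => ?_
      exact le_iSup_of_le (x + z) (le_iSup_of_le (by simpa using hz) le_rfl)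
  rw [h]
  refine (lowerSemicontinuous_iSup fun t => lowerSemicontinuous_iSup fun ht =>
    lowerSemicontinuous_iSup fun z => lowerSemicontinuous_iSup fun _ => ?_).measurable
  have hc := hf.continuous_conv (sdilate t ψ)
  rw [coe_sdilate (ne_of_gt ht)] at hc
  exact (hc.enorm.comp (continuous_add_const z)).lowerSemicontinuous

/-- A function bounded on the ball `B(y, r)` from below by `c` has a large maximal function also
away from the ball. -/
lemma le_mul_tentMaximal_of_forall_le {G : Rn n → ℝ≥0∞} {c : ℝ≥0∞} {x y : Rn n} {r : ℝ}
    (hr : 0 < r) (h : ∀ z ∈ ball y r, c ≤ G z) :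
    c ≤ ENNReal.ofReal ((1 + ‖y - x‖ / r) ^ n) * tentMaximal volume 1 G x := by
  set R := r + ‖y - x‖ with hR
  have hR0 : 0 < R := by positivity
  have hv0 : volume (ball (0 : Rn n) 1) ≠ 0 := (measure_ball_pos _ _ one_pos).ne'
  have hv1 : volume (ball (0 : Rn n) 1) ≠ ∞ := measure_ball_lt_top.ne
  have hvol (z : Rn n) {ρ : ℝ} (hρ : 0 < ρ) :
      volume (ball z ρ) = ENNReal.ofReal (ρ ^ n) * volume (ball (0 : Rn n) 1) := by
    rw [Measure.addHaar_ball_of_pos _ _ hρ, finrank_euclideanSpace_fin]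
  have h1 : c * volume (ball y r) ≤ volume (ball x R) * tentMaximal volume 1 G x := by
    calc c * volume (ball y r) = ∫⁻ _ in ball y r, c := (setLIntegral_const _ _).symm
      _ ≤ ∫⁻ z in ball y r, G z := setLIntegral_mono' measurableSet_ball h
      _ ≤ ∫⁻ z in ball x R, G z := by
          refine lintegral_mono_set (ball_subset_ball' ?_)
          rw [dist_eq_norm]
      _ = volume (ball x R) * ((volume (ball x R))⁻¹ * ∫⁻ z in ball x R, G z) := by
          rw [← mul_assoc, ENNReal.mul_inv_cancel (measure_ball_pos _ _ hR0).ne'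
            measure_ball_lt_top.ne, one_mul]
      _ ≤ volume (ball x R) * tentMaximal volume 1 G x :=
          mul_le_mul_right (le_tentMaximal (by simpa using hR0)) _
  rw [hvol y hr, hvol x hR0] at h1
  have hr0 : ENNReal.ofReal (r ^ n) ≠ 0 := by
    have : 0 < r ^ n := by positivity
    simpa using this
  have h2 : ENNReal.ofReal (R ^ n) =
      ENNReal.ofReal (r ^ n) * ENNReal.ofReal ((1 + ‖y - x‖ / r) ^ n) := by
    rw [← ENNReal.ofReal_mul (by positivity), ← mul_pow]
    congr 2
    rw [hR]
    field_simp
  rw [h2] at h1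
  refine (ENNReal.mul_le_mul_iff_right (mul_ne_zero hr0 hv0)
    (ENNReal.mul_ne_top ENNReal.ofReal_ne_top hv1)).1 ?_
  calc ENNReal.ofReal (r ^ n) * volume (ball (0 : Rn n) 1) * c
      = c * (ENNReal.ofReal (r ^ n) * volume (ball (0 : Rn n) 1)) := mul_comm _ _
    _ ≤ _ := h1
    _ = _ := by ring

/-- The Kakeya maximal function is pointwise controlled by the Hardy-Littlewood maximal function
of the nontangential maximal function. -/
theorem IsCutoff.exists_kakeyaMaximal_le {φ : 𝓢(Rn n, ℂ)} (hφ : IsCutoff φ) (hn : n ≠ 0) :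
    ∃ C : ℝ, 0 < C ∧ ∀ α β : Fin n → ℕ, 2 * n + 1 ≤ multiLen α → 2 * n + 1 ≤ multiLen β →
      ∀ δ : ℝ, 0 < δ → δ < 1 → ∀ f : Rn n → ℂ, WeightedIntegrable f → ∀ x,
      kakeyaMaximal δ α β f x ≤
        ENNReal.ofReal C * tentMaximal volume 1 (nontangentialMaximal (dilate δ φ) f) x := by
  obtain ⟨C, hC, hmain⟩ := hφ.exists_enorm_conv_anisoDilate_le hn
  refine ⟨C, hC, fun α β hα hβ δ hδ hδ1 f hf x => ?_⟩
  refine iSup_le fun t => iSup_le fun ht => iSup_le fun A => iSup_le fun g => iSup_le fun hg => ?_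
  have h := hmain α β hα hβ g hg δ hδ hδ1 (fun u => f (x + t • A u)) (hf.comp_similarity x ht A)
    (tentMaximal volume 1 (nontangentialMaximal (dilate δ φ) f) x) ?_
  · rw [conv_dilate_isometry ht]
    simpa only [conv, zero_sub, map_neg, smul_neg, ← sub_eq_add_neg] using h
  · intro τ hτ u
    -- Rotation invariance of `φ` lets the rotated, rescaled function be convolved with the same
    -- cutoff, so `A` disappears from the kernel.
    have hrad : (fun y => dilate (t * τ * δ) φ (A.symm y)) = dilate (t * τ * δ) φ := by
      ext y
      simp only [dilate, ← map_smul, hφ.apply_isometry]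
    have hconv : conv (fun u => f (x + t • A u)) (dilate (δ * τ) φ) u =
        conv f (dilate (t * τ) (dilate δ φ)) (x + t • A u) := by
      rw [conv_dilate (by positivity), dilate_dilate, ← hrad, conv_dilate_isometry (by positivity)]
      refine integral_congr_ae (Filter.Eventually.of_forall fun y => ?_)
      simp only [map_sub, map_smul, smul_sub, smul_smul]
      rw [show t * (δ * τ) = t * τ * δ by ring, add_sub_assoc]
    rw [hconv]
    -- With `φ_δ` as base function, every `z` within `t * τ` of the point sees the value
    -- nontangentially at height `t * τ`; the ratio `‖t • A u‖ / (t * τ)` is `‖u‖ / τ`.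
    have hkey := le_mul_tentMaximal_of_forall_le (x := x) (y := x + t • A u) (r := t * τ)
      (G := nontangentialMaximal (dilate δ φ) f) (by positivity) fun z hz =>
        le_nontangentialMaximal (dilate δ φ) f (x := z) (by positivity : 0 < t * τ) (by
          rw [mem_ball, dist_eq_norm] at hz
          exact hz.le)
    refine hkey.trans (le_of_eq ?_)
    rw [add_sub_cancel_left, norm_smul, A.norm_map, Real.norm_of_nonneg ht.le,
      mul_div_mul_left _ _ ht.ne']

/-- A bound for convolutions with dilations of a Schwartz function by averages over balls. -/
lemma exists_enorm_conv_dilate_le (φ : 𝓢(Rn n, ℂ)) :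
    ∃ C : ℝ, 0 < C ∧ ∀ f : Rn n → ℂ, AEStronglyMeasurable f volume → ∀ r : ℝ, 0 < r →
      ∀ (y : Rn n) (X : ℝ≥0∞),
      (∀ k : ℕ, (volume (ball y (2 ^ k * r)))⁻¹ * ∫⁻ z in ball y (2 ^ k * r), ‖f z‖ₑ ≤ X) →
      ‖conv f (dilate r φ) y‖ₑ ≤ ENNReal.ofReal C * X := by
  obtain ⟨B, hB, hφ⟩ := exists_norm_le_inv_one_add_norm_pow φ (n + 1)
  have hv0 : 0 < volume (ball (0 : Rn n) 1) := measure_ball_pos _ _ one_pos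
  have hv1 : volume (ball (0 : Rn n) 1) ≠ ∞ := measure_ball_lt_top.ne
  set v := (volume (ball (0 : Rn n) 1)).toReal with hv
  have hvpos : 0 < v := ENNReal.toReal_pos hv0.ne' hv1
  refine ⟨B * 2 ^ (n + 1) * v * 2 + 1, by positivity, fun f hf r hr y X hX => ?_⟩
  set b : ℕ → ℝ := fun k => (r ^ n)⁻¹ * (B * 2 ^ (n + 1) * ((2 ^ k) ^ (n + 1))⁻¹) with hb
  -- Dyadic layers: decay `2^{-k(n+1)}` against volume `2^{kn}` leaves `2^{-k}`. As `2^k ≤ 1 + ‖u‖ <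
  -- 2^(k+1)`, the ball has index `k + 1`, which costs the factor `2 ^ (n + 1)` in `b`.
  have hpoint (w : Rn n) : ‖dilate r φ (y - w)‖ₑ ≤
      ∑' k : ℕ, (ball y (2 ^ k * r)).indicator (fun _ => ENNReal.ofReal (b k)) w := by
    set u := r⁻¹ • (y - w) with hu
    obtain ⟨k, hk1, hk2⟩ := exists_nat_pow_near (x := 1 + ‖u‖) (y := 2) (by simp) one_lt_two
    have hmem : w ∈ ball y (2 ^ (k + 1) * r) := by
      have h1 : ‖u‖ = ‖y - w‖ / r := by
        rw [hu, norm_smul, Real.norm_of_nonneg (by positivity), inv_mul_eq_div]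
      have h2 : ‖y - w‖ / r < 2 ^ (k + 1) := by linarith
      rw [mem_ball, dist_comm, dist_eq_norm]
      exact (div_lt_iff₀ hr).1 h2
    refine le_trans ?_ (ENNReal.le_tsum (k + 1))
    rw [Set.indicator_of_mem hmem, ← ofReal_norm]
    refine ENNReal.ofReal_le_ofReal ?_
    rw [dilate, norm_mul, Complex.norm_real, Real.norm_of_nonneg (by positivity)]
    refine mul_le_mul_of_nonneg_left ((hφ u).trans ?_) (by positivity)
    rw [mul_assoc]
    refine mul_le_mul_of_nonneg_left ?_ hB
    rw [← div_eq_mul_inv, ← div_pow, ← inv_pow]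
    refine pow_le_pow_left₀ (by positivity) ?_ _
    rw [inv_le_comm₀ (by positivity) (by positivity), inv_div, pow_succ]
    linarith
  have hball (k : ℕ) : ∫⁻ w in ball y (2 ^ k * r), ‖f w‖ₑ ≤
      ENNReal.ofReal ((2 ^ k * r) ^ n * v) * X := by
    have h0 : volume (ball y (2 ^ k * r)) ≠ 0 := (measure_ball_pos _ _ (by positivity)).ne'
    have h1 : volume (ball y (2 ^ k * r)) ≠ ∞ := measure_ball_lt_top.ne
    have h2 := hX k
    rw [← ENNReal.div_eq_inv_mul, ENNReal.div_le_iff_le_mul (Or.inl h0) (Or.inl h1), mul_comm X,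
      Measure.addHaar_ball_of_pos _ _ (by positivity), finrank_euclideanSpace_fin] at h2
    rwa [ENNReal.ofReal_mul (by positivity), hv, ENNReal.ofReal_toReal hv1]
  rw [conv_eq_integral_sub]
  calc ‖∫ w, f w * dilate r φ (y - w)‖ₑ ≤ ∫⁻ w, ‖f w * dilate r φ (y - w)‖ₑ :=
        enorm_integral_le_lintegral_enorm _
    _ ≤ ∫⁻ w, ∑' k : ℕ, ‖f w‖ₑ *
          (ball y (2 ^ k * r)).indicator (fun _ => ENNReal.ofReal (b k)) w := by
        refine lintegral_mono fun w => ?_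
        simp only
        rw [enorm_mul, ENNReal.tsum_mul_left]
        exact mul_le_mul_right (hpoint w) _
    _ = ∑' k : ℕ, ∫⁻ w, ‖f w‖ₑ *
          (ball y (2 ^ k * r)).indicator (fun _ => ENNReal.ofReal (b k)) w :=
        lintegral_tsum fun k =>
          hf.enorm.mul (measurable_const.indicator measurableSet_ball).aemeasurable
    _ ≤ ∑' k : ℕ, ENNReal.ofReal (B * 2 ^ (n + 1) * v) * X * (2⁻¹ : ℝ≥0∞) ^ k := by
        refine ENNReal.tsum_le_tsum fun k => ?_
        have h1 (w : Rn n) : ‖f w‖ₑ *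
            (ball y (2 ^ k * r)).indicator (fun _ => ENNReal.ofReal (b k)) w =
            (ball y (2 ^ k * r)).indicator (fun w => ‖f w‖ₑ * ENNReal.ofReal (b k)) w := by
          by_cases h : w ∈ ball y (2 ^ k * r)
          · rw [Set.indicator_of_mem h, Set.indicator_of_mem h]
          · rw [Set.indicator_of_notMem h, Set.indicator_of_notMem h, mul_zero]
        simp only [h1]
        rw [lintegral_indicator measurableSet_ball, lintegral_mul_const' _ _ ENNReal.ofReal_ne_top]
        refine (mul_le_mul_left (hball k) _).trans (le_of_eq ?_)
        have h2 : (2⁻¹ : ℝ≥0∞) ^ k = ENNReal.ofReal ((2 ^ k)⁻¹) := by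
          rw [← inv_pow, ENNReal.ofReal_pow (by norm_num), ENNReal.ofReal_inv_of_pos two_pos,
            ENNReal.ofReal_ofNat]
        rw [h2, mul_right_comm, ← ENNReal.ofReal_mul (by positivity), mul_right_comm _ X,
          ← ENNReal.ofReal_mul (by positivity)]
        congr 2
        simp only [hb]
        rw [mul_pow, pow_succ (2 ^ k : ℝ)]
        field_simp
    _ = ENNReal.ofReal (B * 2 ^ (n + 1) * v * 2) * X := by
        rw [ENNReal.tsum_mul_left, ENNReal.tsum_geometric, ENNReal.one_sub_inv_two, inv_inv,
          ENNReal.ofReal_mul (by positivity : 0 ≤ B * 2 ^ (n + 1) * v), ENNReal.ofReal_ofNat]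
        ring
    _ ≤ _ := by
        gcongr
        linarith

/-- The nontangential maximal function of `f * φ_δ` is pointwise controlled by the maximal function
of aperture `2 / δ`. -/
lemma exists_nontangentialMaximal_le (φ : 𝓢(Rn n, ℂ)) :
    ∃ C : ℝ, 0 < C ∧ ∀ f : Rn n → ℂ, AEStronglyMeasurable f volume → ∀ δ : ℝ, 0 < δ → ∀ x,
      nontangentialMaximal (dilate δ φ) f x ≤
        ENNReal.ofReal C * tentMaximal volume (2 / δ) (fun z => ‖f z‖ₑ) x := by
  obtain ⟨C, hC, h⟩ := exists_enorm_conv_dilate_le φ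
  refine ⟨C, hC, fun f hf δ hδ x => ?_⟩
  refine iSup_le fun t => iSup_le fun ht => iSup_le fun y => iSup_le fun hxy => ?_
  rw [dilate_dilate]
  -- The kernel lives at scale `t * δ` while `x` may be `t` away, so aperture `1 / δ` is needed; the
  -- 2 makes the inequality strict.
  refine h f hf (t * δ) (by positivity) y _ fun k => le_tentMaximal ?_
  rw [dist_eq_norm]
  have h1 : 2 / δ * (2 ^ k * (t * δ)) = 2 * 2 ^ k * t := by
    field_simp
  have h2 : (1 : ℝ) ≤ 2 ^ k := one_le_pow₀ (by norm_num)
  rw [h1]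
  nlinarith

end Nontangential

end KakeyaMax

/-! ### The two norm inequalities. -/

theorem proposition3p3 (n : ℕ) (hn : 2 ≤ n) :
    ∃ L : ℕ, ∀ α β : Fin n → ℕ, L ≤ KakeyaMax.multiLen α → L ≤ KakeyaMax.multiLen β →
      ∀ p : ℝ≥0∞, 1 < p → ∀ φ : 𝓢(KakeyaMax.Rn n, ℂ), KakeyaMax.IsCutoff φ →
      ∀ ε : ℝ, 0 < ε → ∃ C : ℝ, 0 < C ∧
        ∀ δ : ℝ, 0 < δ → δ < 1 →
        ∀ f : KakeyaMax.Rn n → ℂ, MemLp f p volume →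
          eLpNorm (KakeyaMax.kakeyaMaximal δ α β f) p volume ≤
              ENNReal.ofReal (C * (1 / δ) ^ ε) *
                eLpNorm (KakeyaMax.nontangentialMaximal (KakeyaMax.dilate δ φ) f) p volume ∧
          eLpNorm (KakeyaMax.kakeyaMaximal δ α β f) p volume ≤
              ENNReal.ofReal (C * (1 / δ) ^ ((n : ℝ) / p.toReal + ε)) *
                eLpNorm f p volume := by
  refine ⟨2 * n + 1, fun α β hα hβ p hp φ hφ ε hε => ?_⟩
  have hn0 : n ≠ 0 := by omega
  have : Nonempty (Fin n) := ⟨⟨0, by omega⟩⟩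
  obtain ⟨C₁, hC₁, hkak⟩ := hφ.exists_kakeyaMaximal_le hn0
  obtain ⟨C₂, hC₂, hnt⟩ := KakeyaMax.exists_nontangentialMaximal_le φ
  obtain ⟨C₃, hC₃, hmax⟩ := KakeyaMax.exists_eLpNorm_tentMaximal_le
    (volume : Measure (KakeyaMax.Rn n)) hp
  rw [finrank_euclideanSpace_fin] at hmax
  set θ : ℝ := (n : ℝ) / p.toReal with hθ
  have hθ0 : 0 ≤ θ := by positivity
  -- One summand for each inequality. The second uses the `L^p` bound twice, at apertures 1 and `2 /
  -- δ`; the latter gives `2 ^ θ * (1 / δ) ^ θ`.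
  refine ⟨C₁ * C₃ + C₁ * C₃ * C₂ * C₃ * 2 ^ θ, by positivity, fun δ hδ hδ1 f hf => ?_⟩
  have hδinv : 1 ≤ 1 / δ := by
    rw [one_div]
    exact (one_le_inv₀ hδ).2 hδ1.le
  have hδε : 1 ≤ (1 / δ) ^ ε := Real.one_le_rpow hδinv hε.le
  have hw := KakeyaMax.weightedIntegrable_of_memLp hp.le hf
  set G := KakeyaMax.nontangentialMaximal (KakeyaMax.dilate δ φ) f with hG
  have hGm : Measurable G := by
    have := KakeyaMax.measurable_nontangentialMaximal hw (KakeyaMax.sdilate δ φ)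
    rwa [KakeyaMax.coe_sdilate hδ.ne'] at this
  have h1 : eLpNorm (KakeyaMax.kakeyaMaximal δ α β f) p volume ≤
      ENNReal.ofReal (C₁ * C₃) * eLpNorm G p volume := by
    have h2 := eLpNorm_le_nnreal_smul_eLpNorm_of_ae_le_mul' (μ := volume) (c := C₁.toNNReal)
      (f := KakeyaMax.kakeyaMaximal δ α β f) (g := KakeyaMax.tentMaximal volume 1 G)
      (Filter.Eventually.of_forall fun x => hkak α β hα hβ δ hδ hδ1 f hw x) p
    refine h2.trans ?_
    rw [ENNReal.smul_def, smul_eq_mul, ENNReal.ofReal_mul hC₁.le, mul_assoc]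
    refine mul_le_mul_right ?_ _
    have h3 := hmax 1 le_rfl G hGm.aemeasurable
    rwa [Real.one_rpow, mul_one] at h3
  have h4 : eLpNorm G p volume ≤
      ENNReal.ofReal (C₂ * C₃ * 2 ^ θ * (1 / δ) ^ θ) * eLpNorm f p volume := by
    have h2 := eLpNorm_le_nnreal_smul_eLpNorm_of_ae_le_mul' (μ := volume) (c := C₂.toNNReal)
      (f := G) (g := KakeyaMax.tentMaximal volume (2 / δ) (fun z => ‖f z‖ₑ))
      (Filter.Eventually.of_forall fun x => hnt f hf.1 δ hδ x) p
    refine h2.trans ?_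
    have h3 := hmax (2 / δ) (by rw [le_div_iff₀ hδ]; linarith) _ hf.1.enorm
    rw [eLpNorm_enorm] at h3
    rw [ENNReal.smul_def, smul_eq_mul, mul_assoc C₂, mul_assoc C₂, ENNReal.ofReal_mul hC₂.le,
      mul_assoc (ENNReal.ofReal C₂)]
    refine mul_le_mul_right (h3.trans (le_of_eq ?_)) _
    rw [← mul_one_div 2 δ, Real.mul_rpow two_pos.le (by positivity), mul_assoc]
  constructor
  · refine h1.trans (mul_le_mul_left (ENNReal.ofReal_le_ofReal ?_) _)
    calc C₁ * C₃ ≤ C₁ * C₃ + C₁ * C₃ * C₂ * C₃ * 2 ^ θ :=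
          le_add_of_nonneg_right (by positivity)
      _ ≤ (C₁ * C₃ + C₁ * C₃ * C₂ * C₃ * 2 ^ θ) * (1 / δ) ^ ε :=
          le_mul_of_one_le_right (by positivity) hδε
  · refine (h1.trans (mul_le_mul_right h4 _)).trans ?_
    rw [← mul_assoc, ← ENNReal.ofReal_mul (by positivity)]
    refine mul_le_mul_left (ENNReal.ofReal_le_ofReal ?_) _
    rw [Real.rpow_add (by positivity)]
    calc C₁ * C₃ * (C₂ * C₃ * 2 ^ θ * (1 / δ) ^ θ)
        = (C₁ * C₃ * C₂ * C₃ * 2 ^ θ) * ((1 / δ) ^ θ * 1) := by ring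
      _ ≤ (C₁ * C₃ + C₁ * C₃ * C₂ * C₃ * 2 ^ θ) * ((1 / δ) ^ θ * (1 / δ) ^ ε) := by
          gcongr
          exact le_add_of_nonneg_left (by positivity)
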